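/- **Setting.** Let $\Bbbk$ be an algebraically closed field and let $\mathcal C$ be a fiat $2$-category over $\Bbbk$: a strict $2$-category with finitely many objects such that every $\mathcal C(\mathtt i,\mathtt j)$ is an additive, idempotent complete $\Bbbk$-linear category with finite dimensional morphism spaces and finitely many isomorphism classes of indecomposable objects, horizontal composition is biadditive, every identity $1$-morphism $\mathbb 1_{\mathtt i}$ is indecomposable, and there is a weak involution $F\mapsto F^*$ (reversing $1$- and $2$-morphisms and fixing objects) such that for every $1$-morphism $F:\mathtt i\to\mathtt j$ there are $2$-morphisms $F\circ F^*\to\mathbb 1_{\mathtt j}$ and $\mathbb 1_{\mathtt i}\to F^*\circ F$ satisfying the adjunction (zig-zag) identities. **Cells.** For indecomposable $1$-morphisms $F,G$ (up to isomorphism) write $F\le_R G$, $F\le_L G$, $F\le_{LR}G$ if $G$ is a direct summand of $H\circ F$, of $F\circ H$, of $H_2\circ F\circ H_1$, respectively, for some $1$-morphisms $H,H_1,H_2$. Right, left and two-sided cells are the equivalence classes of these preorders. A two-sided cell $\mathcal Q$ is strongly regular if different right cells inside $\mathcal Q$ are incomparable for $\le_R$ and $|\mathcal L\cap\mathcal R|=1$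 for every left cell $\mathcal L$ and right cell $\mathcal R$ in $\mathcal Q$. **Cell $2$-representations.** Let $\overline{\mathcal C}(\mathtt i,\mathtt j)$ be the category of diagrams $F\to G$ in $\mathcal C(\mathtt i,\mathtt j)$ and commutative squares modulo homotopy (the abelianization, in which $F\to G$ represents its cokernel), let $\mathbf P_{\mathtt i}:\mathtt j\mapsto\overline{\mathcal C}(\mathtt i,\mathtt j)$ be the principal $2$-representation, in which $1$- and $2$-morphisms act by horizontal composition, and let $P_F=(0\to F)$. Let $\mathcal R$ be a right cell whose elements have source $\mathtt i$. There is a unique subobject $K\subset P_{\mathbb 1_{\mathtt i}}$ such that every simple subquotient of $P_{\mathbb 1_{\mathtt i}}/K$ is annihilated by all $F\in\mathcal R$, while $K$ has a simple top $L$ with $F\,L\ne0$ for all $F\in\mathcal R$. The cell $2$-representation $\mathbf C_{\mathcal R}$ is the restriction of $\mathbf P_{\mathtt i}$ to the full subcategories $\mathbf C_{\mathcal R}(\mathtt j)\subset\mathbf P_{\mathtt i}(\mathtt j)$ of objects $M$ with an exact presentation $X_1\to X_0\to M\to0$ where $X_1,X_0$ are direct summands of finite direct sums of objects $F\,L$,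 $F\in\mathcal R\cap\mathcal C(\mathtt i,\mathtt j)$. **The $2$-category $\mathcal C_{\mathcal Q}$.** Let $\mathcal I_{\mathcal Q}$ be the $2$-ideal of $\mathcal C$ generated by $\mathrm{id}_F$ for all indecomposable $F\not\le_{LR}\mathcal Q$. Then $\mathcal C_{\mathcal Q}$ is the full $2$-subcategory of $\mathcal C/\mathcal I_{\mathcal Q}$ whose $1$-morphisms are obtained from the $\mathbb 1_{\mathtt i}$ and the elements of $\mathcal Q$ by composition, finite direct sums, direct summands and isomorphisms. If $\mathcal R\subset\mathcal Q$, the $2$-ideal $\mathcal I_{\mathcal Q}$ annihilates $\mathbf C_{\mathcal R}$, so $\mathbf C_{\mathcal R}$ is a $2$-representation of $\mathcal C/\mathcal I_{\mathcal Q}$ and can be restricted to $\mathcal C_{\mathcal Q}$. **Strong simplicity.** Let $\mathcal B$ be $\mathcal C$ or $\mathcal C_{\mathcal Q}$, and let $\hat{\mathcal B}$ be its abelian envelope: $1$-morphisms are cokernels $\mathrm{Coker}(\alpha)$ of $2$-morphisms $\alpha$ of $\mathcal B$, $2$-morphisms are those induced by commutative squares in $\mathcal B$. It acts on a $2$-representation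 $\mathbf M$ of $\mathcal B$ by $\mathrm{Coker}(\alpha)\,M=\mathrm{Coker}(\mathbf M(\alpha)_M)$. An object $M\in\mathbf M(\mathtt i)$ generates $\mathbf M$ if for all $\mathtt j$ and $X,Y\in\mathbf M(\mathtt j)$ there are $F,G\in\hat{\mathcal B}(\mathtt i,\mathtt j)$ with $F\,M\cong X$, $G\,M\cong Y$ such that the evaluation map $\mathrm{Hom}_{\hat{\mathcal B}(\mathtt i,\mathtt j)}(F,G)\to\mathrm{Hom}_{\mathbf M(\mathtt j)}(F\,M,G\,M)$ is surjective. $\mathbf M$ is strongly simple if it is nonzero, is generated by some object, and is generated by each simple object of each $\mathbf M(\mathtt i)$. **Proposition.** Let $\mathcal Q$ be a strongly regular two-sided cell of $\mathcal C$ and $\mathcal R$ a right cell in $\mathcal Q$. Then the cell $2$-representation $\mathbf C_{\mathcal R}$ of $\mathcal C$ is strongly simple if and only if its restriction to $\mathcal C_{\mathcal Q}$ is strongly simple. -/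

import Mathlib

open CategoryTheory CategoryTheory.Limits
open scoped Bicategory ZeroObject

universe w v u w' v' u'

namespace CellRep

section Pres

/-- An object of the abelianization of an additive category `A`: a diagram `src ⟶ tgt` in `A`,
thought of as a projective presentation of its cokernel. -/
structure Pres (A : Type u) [Category.{v} A] where
  {src : A}
  {tgt : A}
  hom : src ⟶ tgt

namespace Pres

variable {A : Type u} [Category.{v} A]

/-- A commutative square between two diagrams. -/
@[ext]
structure Square (X Y : Pres A) where
  left : X.src ⟶ Y.src
  right : X.tgt ⟶ Y.tgt
  comm : X.hom ≫ right = left ≫ Y.hom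

def Square.id (X : Pres A) : Square X X := ⟨𝟙 _, 𝟙 _, by simp⟩

def Square.comp {X Y Z : Pres A} (f : Square X Y) (g : Square Y Z) : Square X Z :=
  ⟨f.left ≫ g.left, f.right ≫ g.right, by
    rw [← Category.assoc, f.comm, Category.assoc, g.comm, Category.assoc]⟩

variable [Preadditive A]

/-- Squares are identified modulo those whose right component `β'` factors as `β' = ξ ≫ Y.hom`
for some `ξ`. -/
instance squareSetoid (X Y : Pres A) : Setoid (Square X Y) where
  r f g := ∃ ξ : X.tgt ⟶ Y.src, f.right - g.right = ξ ≫ Y.hom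
  iseqv :=
    { refl := fun f => ⟨0, by simp⟩
      symm := by
        rintro f g ⟨ξ, h⟩
        exact ⟨-ξ, by rw [Preadditive.neg_comp, ← h, neg_sub]⟩
      trans := by
        rintro f g k ⟨ξ, h⟩ ⟨ζ, h'⟩
        exact ⟨ξ + ζ, by rw [Preadditive.add_comp, ← h, ← h']; abel⟩ }

/-- The abelianization: diagrams, and squares modulo the above ideal. For `A = C(i, j)` this is
the category `C̄(i, j)`. -/
instance : Category (Pres A) where
  Hom X Y := _root_.Quotient (squareSetoid X Y)
  id X := ⟦Square.id X⟧
  comp := Quotient.map₂ Square.comp (by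
    rintro f f' ⟨ξ, h⟩ g g' ⟨ζ, h'⟩
    refine ⟨f.right ≫ ζ + ξ ≫ g'.left, ?_⟩
    rw [sub_eq_iff_eq_add] at h h'
    simp only [Square.comp, h, h', Preadditive.add_comp, Preadditive.comp_add, Category.assoc,
      ← g'.comm]
    abel)
  id_comp := by
    rintro X Y ⟨f⟩
    exact congrArg _ (Square.ext (Category.id_comp _) (Category.id_comp _))
  comp_id := by
    rintro X Y ⟨f⟩
    exact congrArg _ (Square.ext (Category.comp_id _) (Category.comp_id _))
  assoc := by
    rintro X Y Z W ⟨f⟩ ⟨g⟩ ⟨h⟩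
    exact congrArg _ (Square.ext (Category.assoc _ _ _) (Category.assoc _ _ _))

/-- The morphism represented by a square. -/
def cls {X Y : Pres A} (f : Square X Y) : X ⟶ Y := Quotient.mk (squareSetoid X Y) f

theorem cls_surj {X Y : Pres A} (f : X ⟶ Y) : ∃ g, cls g = f := Quotient.exists_rep f

theorem cls_eq_iff {X Y : Pres A} (f g : Square X Y) :
    cls f = cls g ↔ ∃ ξ : X.tgt ⟶ Y.src, f.right - g.right = ξ ≫ Y.hom := 
  Quotient.eq

theorem cls_comp {X Y Z : Pres A} (f : Square X Y) (g : Square Y Z) :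
    cls f ≫ cls g = cls (f.comp g) := rfl

theorem cls_id (X : Pres A) : cls (Square.id X) = 𝟙 X := rfl

theorem cls_congr {X Y : Pres A} {f g : Square X Y} (h : f.right = g.right) : cls f = cls g :=
  (cls_eq_iff f g).2 ⟨0, by simp [h]⟩

instance : HasZeroMorphisms (Pres A) where
  zero X Y := ⟨cls ⟨0, 0, by simp⟩⟩
  comp_zero := by
    rintro X Y ⟨f⟩ Z
    exact cls_congr (f := f.comp ⟨0, 0, by simp⟩) (by simp [Square.comp])
  zero_comp := by
    rintro X Y Z ⟨f⟩
    exact cls_congr (f := Square.comp ⟨0, 0, by simp⟩ f) (by simp [Square.comp])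

/-- An isomorphism of diagrams induces an isomorphism in the abelianization. -/
def isoMk {X Y : Pres A} (l : X.src ≅ Y.src) (r : X.tgt ≅ Y.tgt)
    (h : X.hom ≫ r.hom = l.hom ≫ Y.hom) : X ≅ Y where
  hom := cls ⟨l.hom, r.hom, h⟩
  inv := cls ⟨l.inv, r.inv, by rw [Iso.eq_inv_comp, ← Category.assoc, ← h]; simp⟩
  hom_inv_id := cls_congr (by simp [Square.comp, Square.id])
  inv_hom_id := cls_congr (by simp [Square.comp, Square.id])

end Pres

end Pres

section Principal

variable (C : Type u) [Bicategory.{w, v} C] [∀ i j : C, Preadditive (i ⟶ j)]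

/-- Horizontal composition is biadditive. -/
class Biadditive : Prop where
  whiskerLeft_add : ∀ {i j k : C} (F : i ⟶ j) {G H : j ⟶ k} (α β : G ⟶ H),
    F ◁ (α + β) = F ◁ α + F ◁ β
  add_whiskerRight : ∀ {i j k : C} {F G : i ⟶ j} (α β : F ⟶ G) (H : j ⟶ k),
    (α + β) ▷ H = α ▷ H + β ▷ H

variable {C} [Biadditive C]

theorem sub_whiskerRight {i j k : C} {F G : i ⟶ j} (α β : F ⟶ G) (H : j ⟶ k) :
    (α - β) ▷ H = α ▷ H - β ▷ H := by
  rw [eq_sub_iff_add_eq, ← Biadditive.add_whiskerRight, sub_add_cancel]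

theorem whiskerLeft_sub {i j k : C} (F : i ⟶ j) {G H : j ⟶ k} (α β : G ⟶ H) :
    F ◁ (α - β) = F ◁ α - F ◁ β := by
  rw [eq_sub_iff_add_eq, ← Biadditive.whiskerLeft_add, sub_add_cancel]

/-- The action of a 1-morphism `F : j ⟶ k` on `C̄(i, j)`: horizontal composition with `F`.
Composition is written in diagrammatic order, so `X ≫ F` is `F ∘ X`. -/
def presPost (i : C) {j k : C} (F : j ⟶ k) : Pres (i ⟶ j) ⥤ Pres (i ⟶ k) where
  obj X := ⟨X.hom ▷ F⟩
  map {X Y} := Quotient.map (fun f => ⟨f.left ▷ F, f.right ▷ F, by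
      rw [← Bicategory.comp_whiskerRight, f.comm, Bicategory.comp_whiskerRight]⟩) (by
    rintro f g ⟨ξ, h⟩
    exact ⟨ξ ▷ F, by
      rw [← sub_whiskerRight, h, Bicategory.comp_whiskerRight]⟩)
  map_id X := Pres.cls_congr (Bicategory.id_whiskerRight _ _)
  map_comp := by
    rintro X Y Z ⟨f⟩ ⟨g⟩
    exact Pres.cls_congr (Bicategory.comp_whiskerRight _ _ _)

/-- The natural transformation given by horizontal composition with a 2-morphism. -/
def presPost₂ (i : C) {j k : C} {F G : j ⟶ k} (η : F ⟶ G) : presPost i F ⟶ presPost i G where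
  app X := Pres.cls ⟨X.src ◁ η, X.tgt ◁ η, (Bicategory.whisker_exchange _ _).symm⟩
  naturality := by
    rintro X Y ⟨f⟩
    exact Pres.cls_congr (Bicategory.whisker_exchange _ _).symm

/-- The principal 2-representation `P_i : j ↦ C̄(i, j)`. When `C` is strict, the structure
isomorphisms of this pseudofunctor are given by equalities. -/
def principal (i : C) : Pseudofunctor C Cat.{w, max v w} where
  obj j := Cat.of (Pres (i ⟶ j))
  map F := (presPost i F).toCatHom
  map₂ η := (presPost₂ i η).toCatHom₂
  map₂_id F := by
    apply Cat.Hom₂.ext; apply NatTrans.ext; funext X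
    exact Pres.cls_congr (Bicategory.whiskerLeft_id _ _)
  map₂_comp η θ := by
    apply Cat.Hom₂.ext; apply NatTrans.ext; funext X
    exact Pres.cls_congr (Bicategory.whiskerLeft_comp _ _ _)
  mapId j := Cat.Hom.isoMk (NatIso.ofComponents
    (fun X => Pres.isoMk (X := (presPost i (𝟙 j)).obj X) (Y := X) (ρ_ X.src) (ρ_ X.tgt)
      (Bicategory.rightUnitor_naturality _)) (by
      rintro X Y ⟨f⟩
      exact Pres.cls_congr (Bicategory.rightUnitor_naturality _)))
  mapComp {j k l} F G := Cat.Hom.isoMk (NatIso.ofComponents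
    (fun X => Pres.isoMk (X := (presPost i (F ≫ G)).obj X)
      (Y := (presPost i G).obj ((presPost i F).obj X))
      (α_ X.src F G).symm (α_ X.tgt F G).symm
      (Bicategory.associator_inv_naturality_left _ _ _)) (by
      rintro X Y ⟨f⟩
      exact Pres.cls_congr (Bicategory.associator_inv_naturality_left _ _ _)))
  map₂_whisker_left F G H η := by
    apply Cat.Hom₂.ext; apply NatTrans.ext; funext X
    refine Pres.cls_congr ?_
    change X.tgt ◁ F ◁ η = (α_ X.tgt F G).inv ≫ (X.tgt ≫ F) ◁ η ≫ (α_ X.tgt F H).hom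
    simp
  map₂_whisker_right {_ _ _ F G} η H := by
    apply Cat.Hom₂.ext; apply NatTrans.ext; funext X
    refine Pres.cls_congr ?_
    change X.tgt ◁ η ▷ H = (α_ X.tgt F H).inv ≫ (X.tgt ◁ η) ▷ H ≫ (α_ X.tgt G H).hom
    simp
  map₂_associator F G H := by
    apply Cat.Hom₂.ext; apply NatTrans.ext; funext X
    refine Pres.cls_congr ?_
    change X.tgt ◁ (α_ F G H).hom = (α_ X.tgt (F ≫ G) H).inv ≫ (α_ X.tgt F G).inv ▷ H ≫
      𝟙 _ ≫ (α_ (X.tgt ≫ F) G H).hom ≫ (α_ X.tgt F (G ≫ H)).hom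
    simp
  map₂_left_unitor F := by
    apply Cat.Hom₂.ext; apply NatTrans.ext; funext X
    refine Pres.cls_congr ?_
    change X.tgt ◁ (λ_ F).hom = (α_ X.tgt (𝟙 _) F).inv ≫ (ρ_ X.tgt).hom ▷ F ≫ 𝟙 _
    simp
  map₂_right_unitor F := by
    apply Cat.Hom₂.ext; apply NatTrans.ext; funext X
    refine Pres.cls_congr ?_
    change X.tgt ◁ (ρ_ F).hom = (α_ X.tgt F (𝟙 _)).inv ≫ (ρ_ (X.tgt ≫ F)).hom ≫ 𝟙 _
    simp

end Principal

section Sub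

variable {C : Type u} [Bicategory.{w, v} C] (M : Pseudofunctor C Cat.{w', u'})

/-- A family of full subcategories `D j` of `M j` is stable under the action of all
1-morphisms. -/
def IsStable (D : ∀ j : C, ObjectProperty (M.obj j)) : Prop :=
  ∀ ⦃j k : C⦄ (F : j ⟶ k) (X : M.obj j), D j X → D k ((M.map F).toFunctor.obj X)

/-- The 2-representation obtained from `M` by restriction to a stable family of full
subcategories. -/
def subRep (D : ∀ j : C, ObjectProperty (M.obj j)) (hD : IsStable M D) :
    Pseudofunctor C Cat.{w', u'} where
  obj j := Cat.of (D j).FullSubcategory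
  map {j k} F := ((D k).lift ((D j).ι ⋙ (M.map F).toFunctor)
    (fun X => hD F X.obj X.property)).toCatHom
  map₂ η := NatTrans.toCatHom₂
    { app X := ObjectProperty.homMk ((M.map₂ η).toNatTrans.app X.obj)
      naturality X Y f := InducedCategory.hom_ext ((M.map₂ η).toNatTrans.naturality f.hom) }
  map₂_id F := by
    apply Cat.Hom₂.ext; apply NatTrans.ext; funext X; apply InducedCategory.hom_ext
    exact congrArg (fun t => t.toNatTrans.app X.obj) (M.map₂_id F)
  map₂_comp η θ := by
    apply Cat.Hom₂.ext; apply NatTrans.ext; funext X; apply InducedCategory.hom_ext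
    exact congrArg (fun t => t.toNatTrans.app X.obj) (M.map₂_comp η θ)
  mapId j := Cat.Hom.isoMk (NatIso.ofComponents
    (fun X => (D j).isoMk ((Cat.Hom.toNatIso (M.mapId j)).app X.obj))
    (fun f => InducedCategory.hom_ext ((M.mapId j).hom.toNatTrans.naturality f.hom)))
  mapComp {j k l} F G := Cat.Hom.isoMk (NatIso.ofComponents
    (fun X => (D l).isoMk ((Cat.Hom.toNatIso (M.mapComp F G)).app X.obj))
    (fun f => InducedCategory.hom_ext ((M.mapComp F G).hom.toNatTrans.naturality f.hom)))
  map₂_whisker_left F _ _ η := by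
    apply Cat.Hom₂.ext; apply NatTrans.ext; funext X; apply InducedCategory.hom_ext
    exact congrArg (fun t => t.toNatTrans.app X.obj) (M.map₂_whisker_left F η)
  map₂_whisker_right η H := by
    apply Cat.Hom₂.ext; apply NatTrans.ext; funext X; apply InducedCategory.hom_ext
    exact congrArg (fun t => t.toNatTrans.app X.obj) (M.map₂_whisker_right η H)
  map₂_associator F G H := by
    apply Cat.Hom₂.ext; apply NatTrans.ext; funext X; apply InducedCategory.hom_ext
    exact congrArg (fun t => t.toNatTrans.app X.obj) (M.map₂_associator F G H)
  map₂_left_unitor F := by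
    apply Cat.Hom₂.ext; apply NatTrans.ext; funext X; apply InducedCategory.hom_ext
    exact congrArg (fun t => t.toNatTrans.app X.obj) (M.map₂_left_unitor F)
  map₂_right_unitor F := by
    apply Cat.Hom₂.ext; apply NatTrans.ext; funext X; apply InducedCategory.hom_ext
    exact congrArg (fun t => t.toNatTrans.app X.obj) (M.map₂_right_unitor F)

/-- The largest stable family of full subcategories contained in the family `D`; it is `D`
itself as soon as `D` is stable. -/
def stablePart (D : ∀ j : C, ObjectProperty (M.obj j)) (j : C) : ObjectProperty (M.obj j) :=
  fun X => ∃ E : ∀ k : C, ObjectProperty (M.obj k), (∀ k, E k ≤ D k) ∧ IsStable M E ∧ E j X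

theorem isStable_stablePart (D : ∀ j : C, ObjectProperty (M.obj j)) :
    IsStable M (stablePart M D) := by
  rintro j k F X ⟨E, hED, hE, hX⟩
  exact ⟨E, hED, hE, hE F X hX⟩

instance (D : ∀ j : C, ObjectProperty (M.obj j)) (hD : IsStable M D)
    [∀ j, HasZeroMorphisms (M.obj j)] (j : C) : HasZeroMorphisms ((subRep M D hD).obj j) :=
  inferInstanceAs (HasZeroMorphisms (D j).FullSubcategory)

end Sub

section Ideal

variable (C : Type u) [Bicategory.{w, v} C] [∀ i j : C, Preadditive (i ⟶ j)]

/-- A 2-ideal of `C`. -/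
structure TwoIdeal where
  mem : ∀ {i j : C} {F G : i ⟶ j}, (F ⟶ G) → Prop
  zero_mem : ∀ {i j : C} (F G : i ⟶ j), mem (0 : F ⟶ G)
  add_mem : ∀ {i j : C} {F G : i ⟶ j} {α β : F ⟶ G}, mem α → mem β → mem (α + β)
  comp_left : ∀ {i j : C} {F G H : i ⟶ j} (α : F ⟶ G) {β : G ⟶ H}, mem β → mem (α ≫ β)
  comp_right : ∀ {i j : C} {F G H : i ⟶ j} {α : F ⟶ G} (β : G ⟶ H), mem α → mem (α ≫ β)
  whiskerLeft : ∀ {i j k : C} (F : i ⟶ j) {G H : j ⟶ k} {α : G ⟶ H}, mem α → mem (F ◁ α)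
  whiskerRight : ∀ {i j k : C} {F G : i ⟶ j} {α : F ⟶ G} (H : j ⟶ k), mem α → mem (α ▷ H)

namespace TwoIdeal

/-- The quotient 2-category `C / I`: same objects and 1-morphisms as `C`, and 2-morphisms taken
modulo `I`. -/
structure Quo {C : Type u} [Bicategory.{w, v} C] [∀ i j : C, Preadditive (i ⟶ j)]
    (I : TwoIdeal C) where
  as : C

variable {C} (I : TwoIdeal C)

theorem neg_mem {i j : C} {F G : i ⟶ j} {α : F ⟶ G} (h : I.mem α) : I.mem (-α) := by
  simpa using I.comp_left (-𝟙 F) h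

/-- Congruence of 2-morphisms modulo a 2-ideal. -/
@[reducible] def setoid {i j : C} (F G : i ⟶ j) : Setoid (F ⟶ G) where
  r α β := I.mem (α - β)
  iseqv :=
    { refl := fun α => by simpa using I.zero_mem F G
      symm := fun h => by simpa using I.neg_mem h
      trans := fun h h' => by simpa using I.add_mem h h' }

namespace Quo

variable {I}

/-- The 1-morphisms of `C / I` are those of `C`. -/
structure Hom (i j : I.Quo) where
  as : i.as ⟶ j.as

instance (i j : I.Quo) : Category (Hom i j) where
  Hom F G := _root_.Quotient (I.setoid F.as G.as)
  id F := Quotient.mk _ (𝟙 F.as)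
  comp {F G H} := Quotient.map₂ (· ≫ ·) (by
    intro α α' (h : I.mem _) β β' (h' : I.mem _)
    have : α ≫ β - α' ≫ β' = (α - α') ≫ β + α' ≫ (β - β') := by simp
    change I.mem _
    rw [this]
    exact I.add_mem (I.comp_right _ h) (I.comp_left _ h'))
  id_comp := by
    rintro F G ⟨α⟩
    exact congrArg _ (Category.id_comp α)
  comp_id := by
    rintro F G ⟨α⟩
    exact congrArg _ (Category.comp_id α)
  assoc := by
    rintro F G H K ⟨α⟩ ⟨β⟩ ⟨γ⟩
    exact congrArg _ (Category.assoc α β γ)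

/-- The class of a 2-morphism of `C`. -/
def cls {i j : I.Quo} {F G : Hom i j} (α : F.as ⟶ G.as) : F ⟶ G := Quotient.mk _ α

theorem cls_eq_iff {i j : I.Quo} {F G : Hom i j} (α β : F.as ⟶ G.as) :
    (cls α : F ⟶ G) = cls β ↔ I.mem (α - β) :=
  Quotient.eq

/-- An invertible 2-morphism of `C` is invertible in `C / I`. -/
def isoMk {i j : I.Quo} {F G : Hom i j} (e : F.as ≅ G.as) : F ≅ G where
  hom := cls e.hom
  inv := cls e.inv
  hom_inv_id := congrArg (Quotient.mk _) e.hom_inv_id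
  inv_hom_id := congrArg (Quotient.mk _) e.inv_hom_id

variable [Biadditive C]

/-- Left whiskering in `C / I`. -/
def whiskerLeft {i j k : I.Quo} (F : Hom i j) {G H : Hom j k}
    (α : _root_.Quotient (I.setoid G.as H.as)) :
    _root_.Quotient (I.setoid (F.as ≫ G.as) (F.as ≫ H.as)) :=
  Quotient.lift (fun α => Quotient.mk _ (F.as ◁ α)) (fun α β (h : I.mem _) =>
    Quotient.sound (show I.mem _ by
      rw [← whiskerLeft_sub]
      exact I.whiskerLeft _ h)) α

/-- Right whiskering in `C / I`. -/
def whiskerRight {i j k : I.Quo} {F G : Hom i j}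
    (α : _root_.Quotient (I.setoid F.as G.as)) (H : Hom j k) :
    _root_.Quotient (I.setoid (F.as ≫ H.as) (G.as ≫ H.as)) :=
  Quotient.lift (fun α => Quotient.mk _ (α ▷ H.as)) (fun α β (h : I.mem _) =>
    Quotient.sound (show I.mem _ by
      rw [← sub_whiskerRight]
      exact I.whiskerRight _ h)) α

instance : Bicategory I.Quo where
  Hom := Hom
  id i := ⟨𝟙 i.as⟩
  comp F G := ⟨F.as ≫ G.as⟩
  whiskerLeft F _ _ α := whiskerLeft F α
  whiskerRight α H := whiskerRight α H
  associator F G H := isoMk (α_ F.as G.as H.as)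
  leftUnitor F := isoMk (λ_ F.as)
  rightUnitor F := isoMk (ρ_ F.as)
  whiskerLeft_id F G := congrArg (Quotient.mk _) (Bicategory.whiskerLeft_id F.as G.as)
  whiskerLeft_comp := by
    rintro _ _ _ F G H K ⟨α⟩ ⟨β⟩
    exact congrArg (Quotient.mk _) (Bicategory.whiskerLeft_comp F.as α β)
  id_whiskerLeft := by
    rintro _ _ F G ⟨α⟩
    exact congrArg (Quotient.mk _) (Bicategory.id_whiskerLeft α)
  comp_whiskerLeft := by
    rintro _ _ _ _ F G H K ⟨α⟩
    exact congrArg (Quotient.mk _) (Bicategory.comp_whiskerLeft F.as G.as α)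
  id_whiskerRight F G := congrArg (Quotient.mk _) (Bicategory.id_whiskerRight F.as G.as)
  comp_whiskerRight := by
    rintro _ _ _ F G H ⟨α⟩ ⟨β⟩ K
    exact congrArg (Quotient.mk _) (Bicategory.comp_whiskerRight α β K.as)
  whiskerRight_id := by
    rintro _ _ F G ⟨α⟩
    exact congrArg (Quotient.mk _) (Bicategory.whiskerRight_id α)
  whiskerRight_comp := by
    rintro _ _ _ _ F G ⟨α⟩ H K
    exact congrArg (Quotient.mk _) (Bicategory.whiskerRight_comp α H.as K.as)
  whisker_assoc := by
    rintro _ _ _ _ F G H ⟨α⟩ K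
    exact congrArg (Quotient.mk _) (Bicategory.whisker_assoc F.as α K.as)
  whisker_exchange := by
    rintro _ _ _ F G H K ⟨α⟩ ⟨β⟩
    exact congrArg (Quotient.mk _) (Bicategory.whisker_exchange α β)
  pentagon F G H K := congrArg (Quotient.mk _) (Bicategory.pentagon F.as G.as H.as K.as)
  triangle F G := congrArg (Quotient.mk _) (Bicategory.triangle F.as G.as)

/-- The 1-morphism of `C` underlying a 1-morphism of `C / I`. -/
abbrev one {i j : I.Quo} (F : i ⟶ j) : i.as ⟶ j.as := Hom.as F

end Quo

variable [Biadditive C] (M : Pseudofunctor C Cat.{w', u'})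

/-- A 2-representation of `C` on which congruent 2-morphisms act equally, as a 2-representation
of `C / I`. -/
def descend (hM : ∀ ⦃i j : C⦄ ⦃F G : i ⟶ j⦄ (α β : F ⟶ G), I.mem (α - β) → M.map₂ α = M.map₂ β) :
    Pseudofunctor I.Quo Cat.{w', u'} where
  obj i := M.obj i.as
  map F := M.map (Quo.one F)
  map₂ {_ _ F G} α := Quotient.lift (fun α : (Quo.one F) ⟶ (Quo.one G) => M.map₂ α) (hM (F := (Quo.one F)) (G := (Quo.one G))) α
  map₂_id F := M.map₂_id (Quo.one F)
  map₂_comp := by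
    rintro _ _ F G H ⟨α⟩ ⟨β⟩
    exact M.map₂_comp α β
  mapId i := M.mapId i.as
  mapComp F G := M.mapComp (Quo.one F) (Quo.one G)
  map₂_whisker_left := by
    rintro _ _ _ F G H ⟨α⟩
    exact M.map₂_whisker_left (Quo.one F) α
  map₂_whisker_right := by
    rintro _ _ _ F G ⟨α⟩ H
    exact M.map₂_whisker_right α (Quo.one H)
  map₂_associator F G H := M.map₂_associator (Quo.one F) (Quo.one G) (Quo.one H)
  map₂_left_unitor F := M.map₂_left_unitor (Quo.one F)
  map₂_right_unitor F := M.map₂_right_unitor (Quo.one F)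

/-- The part of `M` annihilated by `I`: the objects on which 2-morphisms that are congruent
modulo `I` act equally. It is all of `M` if and only if `I` annihilates `M`. -/
def annihilated (j : C) : ObjectProperty (M.obj j) := fun X =>
  ∀ ⦃k : C⦄ ⦃F G : j ⟶ k⦄ (α β : F ⟶ G), I.mem (α - β) →
    (M.map₂ α).toNatTrans.app X = (M.map₂ β).toNatTrans.app X

theorem isStable_annihilated : IsStable M (I.annihilated M) := by
  intro j k H X hX l F G α β h
  have h' : I.mem (H ◁ α - H ◁ β) := by
    rw [← whiskerLeft_sub]
    exact I.whiskerLeft _ h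
  have h₁ := hX _ _ h'
  rw [M.map₂_whisker_left, M.map₂_whisker_left] at h₁
  have e : ∀ γ : F ⟶ G, (M.map H ◁ M.map₂ γ).toNatTrans.app X =
      (M.map₂ γ).toNatTrans.app ((M.map H).toFunctor.obj X) := fun γ => rfl
  rw [← e, ← e]
  simpa only [Cat.Hom₂.comp_app, cancel_epi, cancel_mono] using h₁

/-- The 2-representation of `C / I` on the part of `M` annihilated by `I`. If `I` annihilates `M`
this is `M` itself, viewed as a 2-representation of `C / I`. -/
def quotientRep : Pseudofunctor I.Quo Cat.{w', u'} :=
  I.descend (subRep M (I.annihilated M) (I.isStable_annihilated M)) (by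
    intro i j F G α β h
    apply Cat.Hom₂.ext; apply NatTrans.ext; funext X; apply InducedCategory.hom_ext
    exact X.property α β h)

instance [∀ j, HasZeroMorphisms (M.obj j)] (j : I.Quo) :
    HasZeroMorphisms ((I.quotientRep M).obj j) :=
  inferInstanceAs (HasZeroMorphisms (I.annihilated M j.as).FullSubcategory)

end TwoIdeal

end Ideal

section FullSub

variable (B : Type u) [Bicategory.{w, v} B]

/-- A class of 1-morphisms containing identities and closed under composition. -/
structure OneSub where
  mem : ∀ {i j : B}, (i ⟶ j) → Prop
  id_mem : ∀ i : B, mem (𝟙 i)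
  comp_mem : ∀ {i j k : B} {F : i ⟶ j} {G : j ⟶ k}, mem F → mem G → mem (F ≫ G)

namespace OneSub

/-- The 2-subcategory with all objects, the 1-morphisms in the given class, and all 2-morphisms
between them. -/
structure Sub {B : Type u} [Bicategory.{w, v} B] (S : OneSub B) where
  as : B

variable {B} (S : OneSub B)

namespace Sub

variable {S}

/-- The 1-morphisms of the 2-subcategory. -/
structure Hom (i j : S.Sub) where
  as : i.as ⟶ j.as
  prop : S.mem as

instance (i j : S.Sub) : Category (Hom i j) where
  Hom F G := F.as ⟶ G.as
  id F := 𝟙 F.as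
  comp α β := α ≫ β
  id_comp {F G} α := Category.id_comp (X := F.as) (Y := G.as) α
  comp_id {F G} α := Category.comp_id (X := F.as) (Y := G.as) α
  assoc {F G H K} α β γ :=
    Category.assoc (W := F.as) (X := G.as) (Y := H.as) (Z := K.as) α β γ

/-- Invertible 2-morphisms remain invertible in the 2-subcategory. -/
def isoMk {i j : S.Sub} {F G : Hom i j} (e : F.as ≅ G.as) : F ≅ G where
  hom := e.hom
  inv := e.inv
  hom_inv_id := e.hom_inv_id
  inv_hom_id := e.inv_hom_id

instance : Bicategory S.Sub where
  Hom := Hom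
  id i := ⟨𝟙 i.as, S.id_mem i.as⟩
  comp F G := ⟨F.as ≫ G.as, S.comp_mem F.prop G.prop⟩
  whiskerLeft F G H α := Bicategory.whiskerLeft F.as (g := G.as) (h := H.as) α
  whiskerRight {_ _ _ F G} α H := Bicategory.whiskerRight (f := F.as) (g := G.as) α H.as
  associator F G H := isoMk (α_ F.as G.as H.as)
  leftUnitor F := isoMk (λ_ F.as)
  rightUnitor F := isoMk (ρ_ F.as)
  whiskerLeft_id F G := Bicategory.whiskerLeft_id F.as G.as
  whiskerLeft_comp {_ _ _} F G H K α β :=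
    Bicategory.whiskerLeft_comp F.as (g := G.as) (h := H.as) (i := K.as) α β
  id_whiskerLeft {_ _ F G} α := Bicategory.id_whiskerLeft (f := F.as) (g := G.as) α
  comp_whiskerLeft F G H K α :=
    Bicategory.comp_whiskerLeft F.as G.as (h := H.as) (h' := K.as) α
  id_whiskerRight F G := Bicategory.id_whiskerRight F.as G.as
  comp_whiskerRight {_ _ _ F G H} α β K :=
    Bicategory.comp_whiskerRight (f := F.as) (g := G.as) (h := H.as) α β K.as
  whiskerRight_id {_ _ F G} α := Bicategory.whiskerRight_id (f := F.as) (g := G.as) α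
  whiskerRight_comp {_ _ _ _ F G} α H K :=
    Bicategory.whiskerRight_comp (f := F.as) (f' := G.as) α H.as K.as
  whisker_assoc F G H α K := Bicategory.whisker_assoc F.as (g := G.as) (g' := H.as) α K.as
  whisker_exchange {_ _ _ F G H K} α β :=
    Bicategory.whisker_exchange (f := F.as) (g := G.as) (h := H.as) (i := K.as) α β
  pentagon F G H K := Bicategory.pentagon F.as G.as H.as K.as
  triangle F G := Bicategory.triangle F.as G.as

/-- The underlying 1-morphism. -/
abbrev one {i j : S.Sub} (F : i ⟶ j) : i.as ⟶ j.as := Hom.as F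

end Sub

variable (M : Pseudofunctor B Cat.{w', u'})

/-- Restriction of a 2-representation to a 2-subcategory. -/
def restrict : Pseudofunctor S.Sub Cat.{w', u'} where
  obj i := M.obj i.as
  map F := M.map (Sub.one F)
  map₂ {_ _ F G} α := M.map₂ (f := (Sub.one F)) (g := (Sub.one G)) α
  map₂_id F := M.map₂_id (Sub.one F)
  map₂_comp {_ _ F G H} α β := M.map₂_comp (f := (Sub.one F)) (g := (Sub.one G)) (h := (Sub.one H)) α β
  mapId i := M.mapId i.as
  mapComp F G := M.mapComp (Sub.one F) (Sub.one G)
  map₂_whisker_left F G H α := M.map₂_whisker_left (Sub.one F) (g := (Sub.one G)) (h := (Sub.one H)) α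
  map₂_whisker_right {_ _ _ F G} α H := M.map₂_whisker_right (f := (Sub.one F)) (g := (Sub.one G)) α (Sub.one H)
  map₂_associator F G H := M.map₂_associator (Sub.one F) (Sub.one G) (Sub.one H)
  map₂_left_unitor F := M.map₂_left_unitor (Sub.one F)
  map₂_right_unitor F := M.map₂_right_unitor (Sub.one F)

instance [∀ j, HasZeroMorphisms (M.obj j)] (j : S.Sub) :
    HasZeroMorphisms ((S.restrict M).obj j) :=
  inferInstanceAs (HasZeroMorphisms (M.obj j.as))

end OneSub

end FullSub

section Fiat

variable (C : Type u) [Bicategory.{w, v} C]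

/-- A (weak) involution: an object-preserving anti-automorphism `*`, reversing 1-morphisms and
2-morphisms, compatible with composition and identities up to coherent isomorphism, and with
`**` naturally isomorphic to the identity. -/
structure Involution where
  star : ∀ {i j : C}, (i ⟶ j) → (j ⟶ i)
  star₂ : ∀ {i j : C} {F G : i ⟶ j}, (F ⟶ G) → (star G ⟶ star F)
  star₂_id : ∀ {i j : C} (F : i ⟶ j), star₂ (𝟙 F) = 𝟙 (star F)
  star₂_comp : ∀ {i j : C} {F G H : i ⟶ j} (α : F ⟶ G) (β : G ⟶ H),
    star₂ (α ≫ β) = star₂ β ≫ star₂ α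
  starId : ∀ i : C, star (𝟙 i) ≅ 𝟙 i
  starComp : ∀ {i j k : C} (F : i ⟶ j) (G : j ⟶ k), star (F ≫ G) ≅ star G ≫ star F
  star₂_whiskerLeft : ∀ {i j k : C} (F : i ⟶ j) {G H : j ⟶ k} (α : G ⟶ H),
    star₂ (F ◁ α) ≫ (starComp F G).hom = (starComp F H).hom ≫ star₂ α ▷ star F
  star₂_whiskerRight : ∀ {i j k : C} {F G : i ⟶ j} (α : F ⟶ G) (H : j ⟶ k),
    star₂ (α ▷ H) ≫ (starComp F H).hom = (starComp G H).hom ≫ star H ◁ star₂ α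
  star₂_associator : ∀ {i j k l : C} (F : i ⟶ j) (G : j ⟶ k) (H : k ⟶ l),
    star₂ (α_ F G H).hom ≫ (starComp (F ≫ G) H).hom ≫ star H ◁ (starComp F G).hom =
      (starComp F (G ≫ H)).hom ≫ (starComp G H).hom ▷ star F ≫ (α_ _ _ _).hom
  star₂_leftUnitor : ∀ {i j : C} (F : i ⟶ j),
    star₂ (λ_ F).hom ≫ (starComp (𝟙 i) F).hom ≫ star F ◁ (starId i).hom = (ρ_ (star F)).inv
  star₂_rightUnitor : ∀ {i j : C} (F : i ⟶ j),
    star₂ (ρ_ F).hom ≫ (starComp F (𝟙 j)).hom ≫ (starId j).hom ▷ star F = (λ_ (star F)).inv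
  starStar : ∀ {i j : C} (F : i ⟶ j), star (star F) ≅ F
  starStar_naturality : ∀ {i j : C} {F G : i ⟶ j} (α : F ⟶ G),
    star₂ (star₂ α) ≫ (starStar G).hom = (starStar F).hom ≫ α

variable (k : Type v') [Field k] [∀ i j : C, Preadditive (i ⟶ j)]
  [∀ i j : C, Linear k (i ⟶ j)] [∀ i j : C, HasZeroObject (i ⟶ j)] [∀ i j : C, HasBinaryBiproducts (i ⟶ j)]

/-- `k`-finitary 2-categories. Additivity of the categories `C(i, j)` is expressed by the
instance arguments. -/
class IsFinitary : Prop extends Biadditive C where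
  finite_objects : Finite C
  idempotentComplete : ∀ i j : C, IsIdempotentComplete (i ⟶ j)
  finiteDimensional : ∀ {i j : C} (F G : i ⟶ j), FiniteDimensional k (F ⟶ G)
  finite_indecomposables : ∀ i j : C, ∃ S : Finset (i ⟶ j),
    ∀ F : i ⟶ j, Indecomposable F → ∃ G ∈ S, Nonempty (F ≅ G)
  indecomposable_id : ∀ i : C, Indecomposable (𝟙 i)

/-- Fiat 2-categories: finitary with an involution `*` such that every `F` has `F*` as right
adjoint: there are `F ∘ F* ⟶ 1` and `1 ⟶ F* ∘ F` satisfying the zig-zag identities. -/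
class IsFiat : Prop extends IsFinitary C k where
  exists_involution : ∃ I : Involution C,
    ∀ {i j : C} (F : i ⟶ j), Nonempty (Bicategory.Adjunction F (I.star F))

end Fiat

section Cells

variable (C : Type u) [Bicategory.{w, v} C] [∀ i j : C, Preadditive (i ⟶ j)]
  [∀ i j : C, HasZeroObject (i ⟶ j)] [∀ i j : C, HasBinaryBiproducts (i ⟶ j)]

/-- Indecomposable 1-morphisms of `C`. -/
structure Indec where
  {src : C}
  {tgt : C}
  mor : src ⟶ tgt
  indec : Indecomposable mor

variable {C}

/-- `G` is (isomorphic to) a direct summand of `F`; all `C(i, j)` are idempotent complete. -/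
def IsSummand {i j : C} (G F : i ⟶ j) : Prop := Nonempty (Retract G F)

/-- Two indecomposable 1-morphisms have the same source and target and are isomorphic. -/
inductive Indec.Iso : Indec C → Indec C → Prop
  | intro {i j : C} {F G : i ⟶ j} (hF : Indecomposable F) (hG : Indecomposable G)
      (e : Nonempty (F ≅ G)) : Indec.Iso ⟨F, hF⟩ ⟨G, hG⟩

/-- The right preorder: `G` is a direct summand of `H ∘ F` for some `H`. -/
inductive LeR : Indec C → Indec C → Prop
  | intro {i j l : C} {F : i ⟶ j} {G : i ⟶ l} (hF : Indecomposable F) (hG : Indecomposable G)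
      (H : j ⟶ l) (h : IsSummand G (F ≫ H)) : LeR ⟨F, hF⟩ ⟨G, hG⟩

/-- The left preorder: `G` is a direct summand of `F ∘ H` for some `H`. -/
inductive LeL : Indec C → Indec C → Prop
  | intro {i j k : C} {F : i ⟶ j} {G : k ⟶ j} (hF : Indecomposable F) (hG : Indecomposable G)
      (H : k ⟶ i) (h : IsSummand G (H ≫ F)) : LeL ⟨F, hF⟩ ⟨G, hG⟩

/-- The two-sided preorder: `G` is a direct summand of `H₂ ∘ F ∘ H₁` for some `H₁`, `H₂`. -/
inductive LeLR : Indec C → Indec C → Prop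
  | intro {i j k l : C} {F : i ⟶ j} {G : k ⟶ l} (hF : Indecomposable F) (hG : Indecomposable G)
      (H₁ : k ⟶ i) (H₂ : j ⟶ l) (h : IsSummand G (H₁ ≫ F ≫ H₂)) : LeLR ⟨F, hF⟩ ⟨G, hG⟩

/-- Right cells, as sets of indecomposable 1-morphisms (all representatives of each
isomorphism class are included). -/
def IsRightCell (R : Set (Indec C)) : Prop := ∃ F, R = {G | LeR F G ∧ LeR G F}

/-- Left cells. -/
def IsLeftCell (L : Set (Indec C)) : Prop := ∃ F, L = {G | LeL F G ∧ LeL G F}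

/-- Two-sided cells. -/
def IsTwoSidedCell (Q : Set (Indec C)) : Prop := ∃ F, Q = {G | LeLR F G ∧ LeLR G F}

/-- Different right cells inside `Q` are not comparable for the right preorder. -/
def IsRegular (Q : Set (Indec C)) : Prop :=
  ∀ R R' : Set (Indec C), IsRightCell R → IsRightCell R' → R ⊆ Q → R' ⊆ Q → R ≠ R' →
    ∀ F ∈ R, ∀ G ∈ R', ¬ LeR F G

/-- `Q` is regular and the intersection of a left cell and a right cell in `Q` consists of exactly
one isomorphism class. -/
def IsStronglyRegular (Q : Set (Indec C)) : Prop :=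
  IsRegular Q ∧ ∀ L R : Set (Indec C), IsLeftCell L → IsRightCell R → L ⊆ Q → R ⊆ Q →
    ∃ F ∈ L ∩ R, ∀ G ∈ L ∩ R, Indec.Iso F G

end Cells

section Abelian

variable {A : Type u} [Category.{v} A]

/-- `X` is a direct summand of a finite direct sum of objects satisfying `S`. -/
def IsAddClosure [HasZeroMorphisms A] (S : ObjectProperty A) : ObjectProperty A := fun X =>
  ∃ (n : ℕ) (Y : Fin n → A) (b : Bicone Y),
    (∀ a, S (Y a)) ∧ Nonempty b.IsBilimit ∧ Nonempty (Retract X b.pt)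

/-- `p` is a cokernel of `f`. -/
def IsCoker [HasZeroMorphisms A] {X Y Z : A} (f : X ⟶ Y) (p : Y ⟶ Z) : Prop :=
  ∃ h : f ≫ p = 0, Nonempty (IsColimit (CokernelCofork.ofπ p h))

/-- `S` is a quotient of a subobject of `X`. -/
def IsSubquotient (S X : A) : Prop :=
  ∃ (N : A) (m : N ⟶ X) (e : N ⟶ S), Mono m ∧ Epi e

/-- `K` has simple top `L`: there is an epimorphism `K ⟶ L` with `L` simple whose kernel contains
every proper subobject of `K`. -/
def HasSimpleTop [HasZeroMorphisms A] (K L : A) : Prop :=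
  Simple L ∧ ∃ t : K ⟶ L, Epi t ∧ ∀ (N : A) (m : N ⟶ K), Mono m → ¬ IsIso m → m ≫ t = 0

end Abelian

section CellRepresentation

variable {C : Type u} [Bicategory.{w, v} C] [∀ i j : C, Preadditive (i ⟶ j)]
  [∀ i j : C, HasZeroObject (i ⟶ j)] [∀ i j : C, HasBinaryBiproducts (i ⟶ j)] [Biadditive C]

/-- The projective object `P_F = (0 ⟶ F)`. -/
noncomputable def Pres.proj {i j : C} (F : i ⟶ j) : Pres (i ⟶ j) :=
  ⟨(0 : (0 : i ⟶ j) ⟶ F)⟩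

/-- `L` is the simple object `L_{G_R}` attached to the right cell `R` with source `i`: the simple
top of a subobject `K` of `P_{1_i}` such that every simple subquotient of `T = P_{1_i} / K` is
annihilated by every `F ∈ R`, whereas `F L ≠ 0` for every `F ∈ R`. -/
def IsCellSimple (R : Set (Indec C)) (i : C) (L : Pres (i ⟶ i)) : Prop :=
  ∃ (K T : Pres (i ⟶ i)) (κ : K ⟶ Pres.proj (𝟙 i)) (q : Pres.proj (𝟙 i) ⟶ T),
    Mono κ ∧ IsCoker κ q ∧
    (∀ S : Pres (i ⟶ i), Simple S → IsSubquotient S T →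
      ∀ {j : C} (F : i ⟶ j) (hF : Indecomposable F), (⟨F, hF⟩ : Indec C) ∈ R →
        IsZero ((presPost i F).obj S)) ∧
    HasSimpleTop K L ∧
    ∀ {j : C} (F : i ⟶ j) (hF : Indecomposable F), (⟨F, hF⟩ : Indec C) ∈ R →
      ¬ IsZero ((presPost i F).obj L)

/-- The objects `F L_{G_R}` of `C̄(i, j)`, for `F ∈ R ∩ C(i, j)`. -/
def cellGen (R : Set (Indec C)) (i j : C) : ObjectProperty (Pres (i ⟶ j)) := fun X =>
  ∃ (L : Pres (i ⟶ i)) (F : i ⟶ j) (hF : Indecomposable F),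
    IsCellSimple R i L ∧ (⟨F, hF⟩ : Indec C) ∈ R ∧ Nonempty (X ≅ (presPost i F).obj L)

/-- The objects `X` of `C̄(i, j)` with a presentation `X₁ ⟶ X₀ ⟶ X ⟶ 0` where `X₁`, `X₀` are
direct summands of finite direct sums of objects `F L_{G_R}`, `F ∈ R`. -/
def cellObj (R : Set (Indec C)) (i j : C) : ObjectProperty (Pres (i ⟶ j)) := fun X =>
  ∃ (X₁ X₀ : Pres (i ⟶ j)) (f : X₁ ⟶ X₀) (p : X₀ ⟶ X),
    IsAddClosure (cellGen R i j) X₁ ∧ IsAddClosure (cellGen R i j) X₀ ∧ IsCoker f p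

instance (i j : C) : HasZeroMorphisms ((principal i).obj j) :=
  inferInstanceAs (HasZeroMorphisms (Pres (i ⟶ j)))

/-- The cell 2-representation `C_R`, obtained by restriction from `P_i`. The family `cellObj R i`
is stable under the action of `C`, so that its stable part is the whole family; taking the stable
part makes the definition independent of the proof of that fact. -/
def cellRep (R : Set (Indec C)) (i : C) : Pseudofunctor C Cat.{w, max v w} :=
  subRep (principal i) (stablePart (principal i) (cellObj R i)) (isStable_stablePart _ _)

instance (R : Set (Indec C)) (i j : C) : HasZeroMorphisms ((cellRep R i).obj j) :=
  inferInstanceAs (HasZeroMorphisms ((subRep (principal i) _ _).obj j))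

/-- Membership in the 2-ideal `I_Q` generated by the identities of all indecomposable `F` with
`F ≰_{LR} Q`. -/
inductive CellIdealMem (Q : Set (Indec C)) : ∀ {i j : C} {F G : i ⟶ j}, (F ⟶ G) → Prop
  | id_mem {i j : C} (F : i ⟶ j) (hF : Indecomposable F)
      (h : ∀ G ∈ Q, ¬ LeLR ⟨F, hF⟩ G) : CellIdealMem Q (𝟙 F)
  | zero_mem {i j : C} (F G : i ⟶ j) : CellIdealMem Q (0 : F ⟶ G)
  | add_mem {i j : C} {F G : i ⟶ j} {α β : F ⟶ G} :
      CellIdealMem Q α → CellIdealMem Q β → CellIdealMem Q (α + β)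
  | comp_left {i j : C} {F G H : i ⟶ j} (α : F ⟶ G) {β : G ⟶ H} :
      CellIdealMem Q β → CellIdealMem Q (α ≫ β)
  | comp_right {i j : C} {F G H : i ⟶ j} {α : F ⟶ G} (β : G ⟶ H) :
      CellIdealMem Q α → CellIdealMem Q (α ≫ β)
  | whiskerLeft {i j k : C} (F : i ⟶ j) {G H : j ⟶ k} {α : G ⟶ H} :
      CellIdealMem Q α → CellIdealMem Q (F ◁ α)
  | whiskerRight {i j k : C} {F G : i ⟶ j} {α : F ⟶ G} (H : j ⟶ k) :
      CellIdealMem Q α → CellIdealMem Q (α ▷ H)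

/-- The 2-ideal `I_Q`. -/
def cellIdeal (Q : Set (Indec C)) : TwoIdeal C where
  mem := CellIdealMem Q
  zero_mem := .zero_mem
  add_mem := .add_mem
  comp_left := .comp_left
  comp_right := .comp_right
  whiskerLeft := .whiskerLeft
  whiskerRight := .whiskerRight

/-- The 1-morphisms of `C_Q`: those of `C / I_Q` obtained from the identities and the elements of
`Q` by composition, finite direct sums, and direct summands (in particular isomorphisms) in
`C / I_Q`. -/
inductive CellSubMem (Q : Set (Indec C)) : ∀ {i j : (cellIdeal Q).Quo}, (i ⟶ j) → Prop
  | id_mem (i : (cellIdeal Q).Quo) : CellSubMem Q (𝟙 i)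
  | cell_mem {i j : (cellIdeal Q).Quo} (F : i ⟶ j) (hF : Indecomposable (TwoIdeal.Quo.one F))
      (h : (⟨_, hF⟩ : Indec C) ∈ Q) : CellSubMem Q F
  | comp_mem {i j k : (cellIdeal Q).Quo} {F : i ⟶ j} {G : j ⟶ k} :
      CellSubMem Q F → CellSubMem Q G → CellSubMem Q (F ≫ G)
  | zero_mem {i j : (cellIdeal Q).Quo} (F : i ⟶ j) (h : IsZero F) : CellSubMem Q F
  | biprod_mem {i j : (cellIdeal Q).Quo} {F G : i ⟶ j} :
      CellSubMem Q F → CellSubMem Q G →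
        CellSubMem Q (⟨TwoIdeal.Quo.one F ⊞ TwoIdeal.Quo.one G⟩ : TwoIdeal.Quo.Hom i j)
  | summand_mem {i j : (cellIdeal Q).Quo} {F G : i ⟶ j} (h : Nonempty (Retract F G)) :
      CellSubMem Q G → CellSubMem Q F

/-- The class of 1-morphisms of `C_Q`. -/
def cellSub (Q : Set (Indec C)) : OneSub (cellIdeal Q).Quo where
  mem := CellSubMem Q
  id_mem := .id_mem
  comp_mem := .comp_mem

/-- The 2-category `C_Q` associated with `Q`. -/
abbrev CellCat (Q : Set (Indec C)) := (cellSub Q).Sub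

/-- The restriction of `C_R` to `C_Q`: view `C_R`, which is annihilated by `I_Q`, as a
2-representation of `C / I_Q`, and restrict it to the full 2-subcategory `C_Q`. -/
def cellRepRestrict (Q R : Set (Indec C)) (i : C) :
    Pseudofunctor (CellCat Q) Cat.{w, max v w} :=
  (cellSub Q).restrict ((cellIdeal Q).quotientRep (cellRep R i))

instance (Q R : Set (Indec C)) (i : C) (j : CellCat Q) :
    HasZeroMorphisms ((cellRepRestrict Q R i).obj j) :=
  inferInstanceAs (HasZeroMorphisms (((cellSub Q).restrict _).obj j))

end CellRepresentation

section StronglySimple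

variable {B : Type u} [Bicategory.{w, v} B] (M : Pseudofunctor B Cat.{w', u'})
  [∀ i, HasZeroMorphisms (M.obj i)]

/-- `X₀` generates `M`. The 1-morphisms of the abelian envelope are the cokernels `Coker(α)` of
2-morphisms `α` of `B`, and its 2-morphisms are those induced by commutative squares `s` in `B`;
`Coker(α)` acts on `X₀` as the cokernel of `M(α)` at `X₀`. So the condition says that there are
1-morphisms `Coker(α)`, `Coker(β)` of the envelope with `Coker(α) X₀ ≅ X`, `Coker(β) X₀ ≅ Y` such
that evaluation at `X₀` maps the 2-morphisms between them onto all morphisms `X ⟶ Y`. -/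
def Generates {i : B} (X₀ : M.obj i) : Prop :=
  ∀ (j : B) (X Y : M.obj j), ∃ (α β : Pres (i ⟶ j))
    (p : (M.map α.tgt).toFunctor.obj X₀ ⟶ X) (q : (M.map β.tgt).toFunctor.obj X₀ ⟶ Y),
    IsCoker ((M.map₂ α.hom).toNatTrans.app X₀) p ∧
    IsCoker ((M.map₂ β.hom).toNatTrans.app X₀) q ∧
    ∀ f : X ⟶ Y, ∃ s : α.Square β, (M.map₂ s.right).toNatTrans.app X₀ ≫ q = p ≫ f

/-- `M` is nontrivial. -/
def IsNontrivial : Prop := ∃ (i : B) (X : M.obj i), ¬ IsZero X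

/-- `M` is cyclic: it is generated by some object. -/
def IsCyclic : Prop := ∃ (i : B) (X : M.obj i), Generates M X

/-- `M` is nontrivial, cyclic, and generated by any simple object. -/
def IsStronglySimple : Prop :=
  IsNontrivial M ∧ IsCyclic M ∧ ∀ (i : B) (X : M.obj i), Simple X → Generates M X

end StronglySimple

end CellRep

open CellRep

/-! The equivalence holds object by object: an object `X₀` generates the cell 2-representation over
$\mathcal C$ if and only if it generates it over $\mathcal C_{\mathcal Q}$. This rests on three
facts.

The ideal $\mathcal I_{\mathcal Q}$ annihilates $\mathbf C_{\mathcal R}$ (`annihilated_cellRep`), so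
both 2-representations have the same objects and morphisms, hence the same zero and simple objects.
The essential point is `leLR_of_not_isZero_presPost`: if $F\,A\,L\ne0$ with $A\in\mathcal R$, then
$F\le_{LR}A$. Indeed $L$ is a quotient of some $P_G$ with $G$ indecomposable, and $P_G$ covers $K$.
As $A$ kills $P_{\mathbb 1}/K$, it is a summand of $A\circ G$; by adjunction and locality of the
endomorphisms of $G$, $G$ is a summand both of $A^*\circ B_2$ and of $(F\circ A)^*\circ B$.
Combining these by means of the involution exhibits $A$ as a summand of a composition containing
$F$.

Passing from $\mathcal C_{\mathcal Q}$ to $\mathcal C$ (`GeneratesAt.of_restrict`), 2-morphisms are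
lifted along the quotient. Squares then commute only modulo the ideal; the error is absorbed by
adding to the target presentation one morphism `z` generating the ideal at the relevant 1-morphism.
It acts by zero, so no cokernel changes.

Passing from $\mathcal C$ to $\mathcal C_{\mathcal Q}$ (`GeneratesAt.bar`), arbitrary 1-morphisms
are replaced by ones from $\mathcal C_{\mathcal Q}$. Take $\tau:E\to\mathbb 1$ with $E$ a finite sum
of $A\circ A^*$, $A\in\mathcal R$, and $\tau$ given by counits. It splits on the objects $A\,L$ in
question, so the truncated bar complex $HEE\to HE\to H$ is right exact there, and right exactness
carries this over to any object presented by them. The complex is natural in $H$, so presentations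
and squares can be replaced together. Every indecomposable summand of $H\circ E$ lies above an
element of $\mathcal Q$: it belongs to $\mathcal Q$ or vanishes modulo $\mathcal I_{\mathcal Q}$
(`cellSubMem_of_mem`). -/

namespace CellRep

/-! ### Krull–Schmidt arguments and finite generation of ideals in Hom-finite additive categories.
-/

section KrullSchmidt

/-- Additive categories with finite dimensional morphism spaces, split idempotents and finitely
many isomorphism classes of indecomposable objects. -/
structure IsFinitaryCategory (k : Type v') [Field k] (A : Type u) [Category.{v} A] [Preadditive A]
    [Linear k A] [HasZeroObject A] [HasBinaryBiproducts A] : Prop where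
  idempotentComplete : IsIdempotentComplete A
  finiteDimensional : ∀ X Y : A, FiniteDimensional k (X ⟶ Y)
  finite_indecomposables : ∃ S : Finset A, ∀ X : A, Indecomposable X → ∃ Y ∈ S, Nonempty (X ≅ Y)

variable {k : Type v'} [Field k] {A : Type u} [Category.{v} A] [Preadditive A] [Linear k A]
  [HasZeroObject A] [HasBinaryBiproducts A]

/-- The endomorphisms of `Y` embed into those of `X` by `a ↦ r.r ≫ a ≫ r.i`. If this were onto, the
identity of `X` would factor through `r.r`, which kills the nonzero object `Z`. -/
theorem finrank_end_lt_of_retract (hA : IsFinitaryCategory k A) {X Y Z : A} (r : Retract Y X)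
    {i : Z ⟶ X} {p : X ⟶ Z} (hip : i ≫ p = 𝟙 Z) (hi : i ≫ r.r = 0) (hZ : ¬ IsZero Z) :
    Module.finrank k (Y ⟶ Y) < Module.finrank k (X ⟶ X) := by
  have := hA.finiteDimensional X X
  let φ : (Y ⟶ Y) →ₗ[k] (X ⟶ X) := (Linear.rightComp k X r.i) ∘ₗ (Linear.leftComp k Y r.r)
  have hφ : ∀ a, φ a = (r.r ≫ a) ≫ r.i := fun a => rfl
  have hinj : Function.Injective φ := by
    intro a b hab
    have h := congrArg (fun t => r.i ≫ t ≫ r.r) hab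
    simpa [hφ] using h
  rw [← LinearMap.finrank_range_of_inj hinj]
  apply Submodule.finrank_lt
  intro htop
  obtain ⟨a, ha⟩ := LinearMap.range_eq_top.1 htop (𝟙 X)
  apply hZ
  rw [IsZero.iff_id_eq_zero, ← hip, ← Category.id_comp p, ← ha, hφ]
  simp [reassoc_of% hi]

/-- Splitting off a nonzero summand lowers the dimension of the endomorphism algebra, so induction
on that dimension terminates. -/
theorem indecomposable_induction (hA : IsFinitaryCategory k A) {P : A → Prop}
    (zero : ∀ X, IsZero X → P X) (indec : ∀ X, Indecomposable X → P X)
    (biprod_mem : ∀ Y Z, P Y → P Z → P (Y ⊞ Z)) (iso : ∀ X Y, (X ≅ Y) → P Y → P X) (X : A) : P X := by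
  induction hn : Module.finrank k (X ⟶ X) using Nat.strong_induction_on generalizing X with
  | _ n ih =>
    by_cases h0 : IsZero X
    · exact zero X h0
    by_cases h : Indecomposable X
    · exact indec X h
    · obtain ⟨Y, Z, e, hY, hZ⟩ : ∃ (Y Z : A) (_ : X ≅ Y ⊞ Z), ¬ IsZero Y ∧ ¬ IsZero Z := by
        by_contra hcon
        push Not at hcon
        exact h ⟨h0, fun Y Z e => or_iff_not_imp_left.2 (hcon Y Z e)⟩
      refine iso _ _ e (biprod_mem _ _ (ih _ ?_ Y rfl) (ih _ ?_ Z rfl))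
      · rw [← hn]
        exact finrank_end_lt_of_retract hA ⟨biprod.inl ≫ e.inv, e.hom ≫ biprod.fst, by simp⟩
          (i := biprod.inr ≫ e.inv) (p := e.hom ≫ biprod.snd) (by simp) (by simp) hZ
      · rw [← hn]
        exact finrank_end_lt_of_retract hA ⟨biprod.inr ≫ e.inv, e.hom ≫ biprod.snd, by simp⟩
          (i := biprod.inl ≫ e.inv) (p := e.hom ≫ biprod.fst) (by simp) (by simp) hY

/-- Splitting both `b` and `𝟙 X - b` writes `X` as the biproduct of their images, one of which must
vanish. -/
theorem Indecomposable.eq_zero_or_eq_id (hA : IsFinitaryCategory k A) {X : A}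
    (hX : Indecomposable X) {b : X ⟶ X} (hb : b ≫ b = b) : b = 0 ∨ b = 𝟙 X := by
  have := hA.idempotentComplete
  obtain ⟨Y, i, e, hie, hei⟩ := this.idempotents_split X b hb
  obtain ⟨Z, i', e', hie', hei'⟩ := this.idempotents_split X (𝟙 X - b) (by simp [hb])
  have h1 : e ≫ i ≫ e' ≫ i' = 0 := by
    rw [hei', ← Category.assoc, hei]; simp [hb]
  have h2 : e' ≫ i' ≫ e ≫ i = 0 := by
    rw [hei, ← Category.assoc, hei']; simp [hb]
  have h3 : i ≫ e' = 0 := by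
    have := congrArg (fun t => i ≫ t ≫ e') h1
    simpa [reassoc_of% hie, hie'] using this
  have h4 : i' ≫ e = 0 := by
    have := congrArg (fun t => i' ≫ t ≫ e) h2
    simpa [reassoc_of% hie', hie] using this
  have iso : X ≅ Y ⊞ Z :=
    { hom := biprod.lift e e'
      inv := biprod.desc i i'
      hom_inv_id := by rw [biprod.lift_desc, hei, hei']; abel
      inv_hom_id := by ext <;> simp [hie, hie', h3, h4] }
  rcases hX.2 _ _ iso with h | h
  · left
    rw [← hei, h.eq_zero_of_tgt e, zero_comp]
  · right
    rw [h.eq_zero_of_tgt e', zero_comp] at hei'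
    exact (sub_eq_zero.1 hei'.symm).symm

/-- Endomorphism rings of indecomposable objects are local. -/
theorem Indecomposable.isIso_or_isIso_id_sub (hA : IsFinitaryCategory k A) {X : A}
    (hX : Indecomposable X) (f : X ⟶ X) : IsIso f ∨ IsIso (𝟙 X - f) := by
  have := hA.finiteDimensional X X
  -- Fitting's lemma for postcomposition with `f`: for large `n`, the endomorphism space is the
  -- direct sum of the kernel and the range of `T ^ n`.
  let T : Module.End k (X ⟶ X) := Linear.rightComp k X f
  have hT : ∀ g, T g = g ≫ f := fun g => rfl
  have hTn : ∀ (n : ℕ) (g h : X ⟶ X), (T ^ n) (g ≫ h) = g ≫ (T ^ n) h := by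
    intro n g h
    induction n with
    | zero => simp
    | succ n ih => simp only [pow_succ', Module.End.mul_apply, ih, hT, Category.assoc]
  obtain ⟨n, hn1, hn⟩ := ((Filter.eventually_ge_atTop 1).and
    (LinearMap.eventually_isCompl_ker_pow_range_pow T)).exists
  obtain ⟨m, rfl⟩ : ∃ m, n = m + 1 := ⟨n - 1, by omega⟩
  obtain ⟨a, ha, b, ⟨c, hc⟩, hab⟩ := Submodule.mem_sup.1
    (hn.sup_eq_top ▸ Submodule.mem_top (x := 𝟙 X))
  have hdisj := Submodule.disjoint_def.1 hn.disjoint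
  rw [LinearMap.mem_ker] at ha
  -- Kernel and range of `T ^ n` are stable under precomposition, so `b ≫ a` lies in both and
  -- vanishes.
  have hbb : b ≫ b = b := by
    have h1 : b ≫ a = b - b ≫ b := by
      rw [eq_sub_iff_add_eq, ← Preadditive.comp_add, hab, Category.comp_id]
    have h2 := hdisj (b ≫ a) (by rw [LinearMap.mem_ker, hTn, ha, comp_zero])
      (by rw [h1]; exact Submodule.sub_mem _ ⟨c, hc⟩ ⟨b ≫ c, by rw [hTn, hc]⟩)
    rw [h1] at h2
    exact (sub_eq_zero.1 h2).symm
  -- If `b = 0`, then `f` is nilpotent and `𝟙 X - f` is invertible. If `b = 𝟙 X`, then `f` has a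
  -- left inverse and is right cancellable.
  rcases Indecomposable.eq_zero_or_eq_id hA hX hbb with rfl | rfl
  · right
    rw [add_zero] at hab
    subst hab
    have hnil : IsNilpotent (show End X from f) := by
      refine ⟨m + 1, ?_⟩
      have : ∀ n, (T ^ n) (𝟙 X) = (show End X from f) ^ n := by
        intro n
        induction n with
        | zero => rfl
        | succ n ih =>
          rw [pow_succ', Module.End.mul_apply, ih, hT, pow_succ']
          rfl
      rw [← this, ha]
    have hu := hnil.isUnit_one_sub
    exact (isUnit_iff_isIso _).1 hu
  · left
    rw [pow_succ', Module.End.mul_apply, hT] at hc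
    have hmono : ∀ g : X ⟶ X, g ≫ f = 0 → g = 0 := by
      intro g hg
      apply hdisj
      · rw [LinearMap.mem_ker, pow_succ, Module.End.mul_apply, hT, hg, map_zero]
      · exact ⟨g ≫ c, by rw [hTn, pow_succ', Module.End.mul_apply, hT, hc, Category.comp_id]⟩
    refine ⟨(T ^ m) c, ?_, hc⟩
    rw [← sub_eq_zero]
    apply hmono
    rw [Preadditive.sub_comp, Category.assoc, hc]
    simp

/-- A family of sets of morphisms to `B` closed under addition and precomposition is generated
by a single morphism. -/
theorem exists_generator (hA : IsFinitaryCategory k A) {B : A} (I : ∀ ⦃X : A⦄, (X ⟶ B) → Prop)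
    (zero : ∀ X, I (0 : X ⟶ B)) (add : ∀ ⦃X⦄ (x y : X ⟶ B), I x → I y → I (x + y))
    (precomp : ∀ ⦃X Y⦄ (a : Y ⟶ X) (x : X ⟶ B), I x → I (a ≫ x)) :
    ∃ (W : A) (w : W ⟶ B), I w ∧ ∀ ⦃X⦄ (x : X ⟶ B), I x → ∃ y : X ⟶ W, y ≫ w = x := by
  classical
  have step1 : ∀ (X : A) (t : Finset (X ⟶ B)), (∀ x ∈ t, I x) →
      ∃ (W : A) (w : W ⟶ B), I w ∧ ∀ x ∈ t, ∃ y : X ⟶ W, y ≫ w = x := by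
    intro X t
    induction t using Finset.induction_on with
    | empty => exact fun _ => ⟨0, 0, zero _, by simp⟩
    | insert x t _ ih =>
      intro ht
      obtain ⟨W, w, hw, h⟩ := ih (fun x hx => ht x (Finset.mem_insert_of_mem hx))
      refine ⟨X ⊞ W, biprod.desc x w, ?_, ?_⟩
      · rw [biprod.desc_eq]
        exact add _ _ (precomp _ _ (ht x (Finset.mem_insert_self _ _))) (precomp _ _ hw)
      · intro z hz
        rcases Finset.mem_insert.1 hz with rfl | hz
        · exact ⟨biprod.inl, by simp⟩
        · obtain ⟨y, hy⟩ := h z hz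
          exact ⟨y ≫ biprod.inr, by simp [hy]⟩
  have step2 : ∀ X : A, ∃ (W : A) (w : W ⟶ B), I w ∧
      ∀ x : X ⟶ B, I x → ∃ y : X ⟶ W, y ≫ w = x := by
    intro X
    have := hA.finiteDimensional X B
    -- Stability under precomposition with scalar multiples of the identity makes the members with
    -- source `X` a subspace, finitely spanned because the morphism spaces are finite dimensional.
    let N : Submodule k (X ⟶ B) :=
      { carrier := {x | I x}
        add_mem' := fun hx hy => add _ _ hx hy
        zero_mem' := zero X
        smul_mem' := fun c x hx => by
          have := precomp (c • 𝟙 X) x hx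
          simpa using this }
    obtain ⟨t, ht⟩ : N.FG := IsNoetherian.noetherian N
    obtain ⟨W, w, hw, h⟩ := step1 X t (fun x hx => by
      have : x ∈ N := ht ▸ Submodule.subset_span hx
      exact this)
    refine ⟨W, w, hw, fun x hx => ?_⟩
    have hx' : x ∈ Submodule.span k (t : Set (X ⟶ B)) := by rw [ht]; exact hx
    have hle : Submodule.span k (t : Set (X ⟶ B)) ≤ LinearMap.range (Linear.rightComp k X w) :=
      Submodule.span_le.2 (fun x hx => h x hx)
    exact hle hx'
  have step3 : ∀ S : Finset A, ∃ (W : A) (w : W ⟶ B), I w ∧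
      ∀ X ∈ S, ∀ x : X ⟶ B, I x → ∃ y : X ⟶ W, y ≫ w = x := by
    intro S
    induction S using Finset.induction_on with
    | empty => exact ⟨0, 0, zero _, by simp⟩
    | insert X S _ ih =>
      obtain ⟨W, w, hw, h⟩ := ih
      obtain ⟨V, u, hu, h'⟩ := step2 X
      refine ⟨V ⊞ W, biprod.desc u w, ?_, ?_⟩
      · rw [biprod.desc_eq]
        exact add _ _ (precomp _ _ hu) (precomp _ _ hw)
      · intro Z hZ z hz
        rcases Finset.mem_insert.1 hZ with rfl | hZ
        · obtain ⟨y, hy⟩ := h' z hz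
          exact ⟨y ≫ biprod.inl, by simp [hy]⟩
        · obtain ⟨y, hy⟩ := h Z hZ z hz
          exact ⟨y ≫ biprod.inr, by simp [hy]⟩
  obtain ⟨S, hS⟩ := hA.finite_indecomposables
  obtain ⟨W, w, hw, h⟩ := step3 S
  refine ⟨W, w, hw, fun X => ?_⟩
  refine indecomposable_induction hA (P := fun X => ∀ x : X ⟶ B, I x → ∃ y : X ⟶ W, y ≫ w = x)
    ?_ ?_ ?_ ?_ X
  · intro X hX x _
    exact ⟨0, hX.eq_of_src _ _⟩
  · intro X hX x hx
    obtain ⟨Y, hY, ⟨e⟩⟩ := hS X hX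
    obtain ⟨y, hy⟩ := h Y hY (e.inv ≫ x) (precomp _ _ hx)
    exact ⟨e.hom ≫ y, by simp [hy]⟩
  · intro Y Z hY hZ x hx
    obtain ⟨y, hy⟩ := hY (biprod.inl ≫ x) (precomp _ _ hx)
    obtain ⟨z, hz⟩ := hZ (biprod.inr ≫ x) (precomp _ _ hx)
    exact ⟨biprod.desc y z, by ext <;> simp [hy, hz]⟩
  · intro X Y e hY x hx
    obtain ⟨y, hy⟩ := hY (e.inv ≫ x) (precomp _ _ hx)
    exact ⟨e.hom ≫ y, by simp [hy]⟩

/-- A morphism out of `X` lying outside a class closed under addition and precomposition remains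
outside of it on some indecomposable direct summand of `X`. -/
theorem exists_indecomposable_retract (hA : IsFinitaryCategory k A) {B : A}
    (I : ∀ ⦃X : A⦄, (X ⟶ B) → Prop)
    (zero : ∀ X, I (0 : X ⟶ B)) (add : ∀ ⦃X⦄ (x y : X ⟶ B), I x → I y → I (x + y))
    (precomp : ∀ ⦃X Y⦄ (a : Y ⟶ X) (x : X ⟶ B), I x → I (a ≫ x)) {X : A} (x : X ⟶ B)
    (hx : ¬ I x) : ∃ (G : A) (r : Retract G X), Indecomposable G ∧ ¬ I (r.i ≫ x) := by
  revert x hx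
  refine indecomposable_induction hA (P := fun X => ∀ x : X ⟶ B, ¬ I x →
    ∃ (G : A) (r : Retract G X), Indecomposable G ∧ ¬ I (r.i ≫ x)) ?_ ?_ ?_ ?_ X
  · intro X hX x hx
    exact absurd (hX.eq_of_src x 0 ▸ zero X) hx
  · intro X hX x hx
    exact ⟨X, Retract.refl X, hX, by simpa [Retract.refl] using hx⟩
  · intro Y Z hY hZ x hx
    by_cases h : I (biprod.inl ≫ x)
    · by_cases h' : I (biprod.inr ≫ x)
      · refine absurd ?_ hx
        have := add _ _ (precomp biprod.fst _ h) (precomp biprod.snd _ h')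
        rwa [← Category.assoc, ← Category.assoc, ← Preadditive.add_comp, biprod.total,
          Category.id_comp] at this
      · obtain ⟨G, r, hG, hr⟩ := hZ _ h'
        exact ⟨G, r.trans ⟨biprod.inr, biprod.snd, by simp⟩, hG, by simpa [Retract.trans] using hr⟩
    · obtain ⟨G, r, hG, hr⟩ := hY _ h
      exact ⟨G, r.trans ⟨biprod.inl, biprod.fst, by simp⟩, hG, by simpa [Retract.trans] using hr⟩
  · intro X Y e hY x hx
    obtain ⟨G, r, hG, hr⟩ := hY (e.inv ≫ x) (fun h => hx (by simpa using precomp e.hom _ h))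
    exact ⟨G, r.trans (Retract.ofIso e.symm), hG, by simpa [Retract.trans, Retract.ofIso] using hr⟩

end KrullSchmidt

/-! ### The abelianization, handled through morphisms from projective objects. -/

namespace Pres

section Abelianization

variable {A : Type u} [Category.{v} A] [Preadditive A]

theorem cls_eq_zero_iff {X Y : Pres A} (s : Square X Y) :
    cls s = 0 ↔ ∃ ξ : X.tgt ⟶ Y.src, s.right = ξ ≫ Y.hom := by
  refine (cls_eq_iff s ⟨0, 0, by simp⟩).trans ?_
  simp

theorem isZero_iff (X : Pres A) : IsZero X ↔ ∃ ξ : X.tgt ⟶ X.src, ξ ≫ X.hom = 𝟙 _ := by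
  rw [IsZero.iff_id_eq_zero, ← cls_id, cls_eq_zero_iff]
  simp only [Square.id, eq_comm]

variable [HasZeroObject A]

/-- The projective object attached to an object of `A`. -/
noncomputable abbrev free (Z : A) : Pres A := ⟨(0 : (0 : A) ⟶ Z)⟩

/-- The morphism from a projective object determined by a morphism of `A`. -/
noncomputable def point {Z : A} {X : Pres A} (x : Z ⟶ X.tgt) : free Z ⟶ X :=
  cls ⟨0, x, by simp⟩

theorem point_eq_zero_iff {Z : A} {X : Pres A} (x : Z ⟶ X.tgt) :
    point x = 0 ↔ ∃ ξ : Z ⟶ X.src, x = ξ ≫ X.hom :=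
  cls_eq_zero_iff _

theorem point_eq_iff {Z : A} {X : Pres A} (x y : Z ⟶ X.tgt) :
    point x = point y ↔ ∃ ξ : Z ⟶ X.src, x - y = ξ ≫ X.hom :=
  cls_eq_iff _ _

theorem point_eq_iff_sub {Z : A} {X : Pres A} (x y : Z ⟶ X.tgt) :
    point x = point y ↔ point (x - y) = 0 := by
  rw [point_eq_iff, point_eq_zero_iff]

theorem point_surj {Z : A} {X : Pres A} (f : free Z ⟶ X) : ∃ x : Z ⟶ X.tgt, point x = f := by
  obtain ⟨s, rfl⟩ := cls_surj f
  exact ⟨s.right, cls_congr rfl⟩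

theorem point_comp_cls {Z : A} {X Y : Pres A} (x : Z ⟶ X.tgt) (s : Square X Y) :
    point x ≫ cls s = point (x ≫ s.right) :=
  cls_congr rfl

theorem point_comp_point {Z Z' : A} {X : Pres A} (a : Z' ⟶ Z) (x : Z ⟶ X.tgt) :
    (point (X := free Z) a : free Z' ⟶ free Z) ≫ point x = point (a ≫ x) :=
  cls_congr rfl

theorem point_self (X : Pres A) : point X.hom = (0 : free X.src ⟶ X) :=
  (point_eq_zero_iff _).2 ⟨𝟙 _, by simp⟩

theorem point_precomp {Z Z' : A} {X Y : Pres A} (a : Z' ⟶ Z) {x : Z ⟶ X.tgt} {y : Z ⟶ Y.tgt}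
    {f : X ⟶ Y} (h : point x ≫ f = point y) : point (a ≫ x) ≫ f = point (a ≫ y) := by
  rw [← point_comp_point, Category.assoc, h, point_comp_point]

theorem point_zero_precomp {Z Z' : A} {X : Pres A} (a : Z' ⟶ Z) {x : Z ⟶ X.tgt}
    (h : point x = 0) : point (a ≫ x) = 0 := by
  rw [← point_comp_point, h, comp_zero]

theorem point_zero {Z : A} {X : Pres A} : point (0 : Z ⟶ X.tgt) = 0 :=
  (point_eq_zero_iff _).2 ⟨0, by simp⟩

theorem point_add_eq_zero {Z : A} {X : Pres A} {x y : Z ⟶ X.tgt} (hx : point x = 0)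
    (hy : point y = 0) : point (x + y) = 0 := by
  obtain ⟨ξ, hξ⟩ := (point_eq_zero_iff _).1 hx
  obtain ⟨ζ, hζ⟩ := (point_eq_zero_iff _).1 hy
  exact (point_eq_zero_iff _).2 ⟨ξ + ζ, by rw [hξ, hζ, Preadditive.add_comp]⟩

theorem point_id_cancel {X Y : Pres A} {f g : X ⟶ Y}
    (h : point (𝟙 X.tgt) ≫ f = point (𝟙 X.tgt) ≫ g) : f = g := by
  obtain ⟨s, rfl⟩ := cls_surj f
  obtain ⟨t, rfl⟩ := cls_surj g
  rw [point_comp_cls, point_comp_cls, point_eq_iff] at h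
  simpa [cls_eq_iff] using h

/-- Epimorphisms of the abelianization, described through lifts of the generating point. -/
def Surj {X Y : Pres A} (f : X ⟶ Y) : Prop :=
  ∃ x : Y.tgt ⟶ X.tgt, point x ≫ f = point (𝟙 _)

theorem Surj.lift {X Y : Pres A} {f : X ⟶ Y} (hf : Surj f) {Z : A} (y : Z ⟶ Y.tgt) :
    ∃ x : Z ⟶ X.tgt, point x ≫ f = point y := by
  obtain ⟨x, hx⟩ := hf
  exact ⟨y ≫ x, by rw [point_precomp y hx, Category.comp_id]⟩

theorem Surj.epi {X Y : Pres A} {f : X ⟶ Y} (hf : Surj f) : Epi f where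
  left_cancellation g h e := by
    obtain ⟨x, hx⟩ := hf
    apply point_id_cancel
    rw [← hx, Category.assoc, Category.assoc, e]

theorem surj_cls_of_right {X Y : Pres A} {s : Square X Y} {x : Y.tgt ⟶ X.tgt}
    (h : x ≫ s.right = 𝟙 _) : Surj (cls s) :=
  ⟨x, by rw [point_comp_cls, h]⟩

/-- Two morphisms into `X` are compared on the projective cover of their source, where their
difference is a point of `X` even though `Pres A` carries no addition here. -/
theorem mono_of_point {X Y : Pres A} {f : X ⟶ Y}
    (h : ∀ (Z : A) (x : Z ⟶ X.tgt), point x ≫ f = 0 → point x = 0) : Mono f where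
  right_cancellation {V} g g' e := by
    obtain ⟨s, rfl⟩ := cls_surj g
    obtain ⟨t, rfl⟩ := cls_surj g'
    apply point_id_cancel
    obtain ⟨m, rfl⟩ := cls_surj f
    rw [point_comp_cls, point_comp_cls, point_eq_iff_sub]
    apply h
    rw [point_comp_cls, Preadditive.sub_comp, ← point_eq_iff_sub, ← point_comp_cls,
      ← point_comp_cls, ← point_comp_cls, ← point_comp_cls, Category.assoc, Category.assoc, e]

/-- Used with `m` the inclusion of the image of `point x`: once simplicity, or a simple top, makes
this image everything, `point x` is onto. -/
theorem surj_of_isIso_image {X : Pres A} {Z W : A} {w : W ⟶ Z} {m : Pres.mk w ⟶ X}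
    (hm : IsIso m) {x : Z ⟶ X.tgt} (h : point (X := Pres.mk w) (𝟙 Z) ≫ m = point x) :
    Surj (point x) := by
  obtain ⟨u, hu⟩ := point_surj (point (𝟙 X.tgt) ≫ inv m)
  refine ⟨u, ?_⟩
  rw [point_comp_point]
  have := point_precomp u h
  rw [Category.comp_id] at this
  rw [← this, hu, Category.assoc, IsIso.inv_hom_id, Category.comp_id]

section Cokernel

variable [HasBinaryBiproducts A]

/-- The cokernel of the morphism represented by a square. -/
noncomputable abbrev coker {X Y : Pres A} (s : Square X Y) : Pres A :=
  ⟨biprod.desc s.right Y.hom⟩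

/-- The projection onto the cokernel. -/
noncomputable def cokerπ {X Y : Pres A} (s : Square X Y) : Y ⟶ coker s :=
  cls ⟨biprod.inr, 𝟙 _, by simp [coker]⟩

/-- A null-homotopy `ξ` of the composite with `t`, glued with `t.left`, is the left component of the
induced morphism. -/
theorem isCoker_cokerπ {X Y : Pres A} (s : Square X Y) : IsCoker (cls s) (cokerπ s) := by
  have h : cls s ≫ cokerπ s = 0 :=
    (cls_eq_zero_iff (s.comp _)).2 ⟨biprod.inl, by simp [coker, Square.comp]⟩
  have : Epi (cokerπ s) := Surj.epi ⟨𝟙 Y.tgt, by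
    rw [cokerπ, point_comp_cls, Category.comp_id]⟩
  refine ⟨h, ⟨CokernelCofork.IsColimit.ofπ' _ _ fun {Z} g hg => Nonempty.some ?_⟩⟩
  obtain ⟨t, rfl⟩ := cls_surj g
  obtain ⟨ξ, hξ⟩ := (cls_eq_zero_iff (s.comp t)).1 hg
  refine ⟨⟨cls (X := coker s) ⟨biprod.desc ξ t.left, t.right, ?_⟩, ?_⟩⟩
  · ext
    · simpa [coker, Square.comp] using hξ
    · simpa [coker] using t.comm
  · exact cls_congr (f := Square.comp _ _) (by simp [Square.comp])

/-- The projection onto the cokernel of an epimorphism is zero. Of its null-homotopy, the first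
component is the required lift and the second accounts for the relation. -/
theorem surj_of_epi {X Y : Pres A} {f : X ⟶ Y} (hf : Epi f) : Surj f := by
  obtain ⟨s, rfl⟩ := cls_surj f
  obtain ⟨h, -⟩ := isCoker_cokerπ s
  have h0 : cokerπ s = 0 := by
    rw [← cancel_epi (cls s), h, comp_zero]
  obtain ⟨ξ, hξ⟩ := (cls_eq_zero_iff _).1 h0
  refine ⟨ξ ≫ biprod.fst, ?_⟩
  rw [point_comp_cls, point_eq_iff]
  refine ⟨-(ξ ≫ biprod.snd), ?_⟩
  dsimp only [coker] at hξ
  rw [biprod.desc_eq, Preadditive.comp_add] at hξ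
  simp only [Category.assoc, Preadditive.neg_comp]
  rw [← sub_eq_zero, ← sub_eq_zero.2 hξ.symm]
  abel

end Cokernel

end Abelianization

section Finitary

variable {k : Type v'} [Field k] {A : Type u} [Category.{v} A] [Preadditive A] [Linear k A]
  [HasZeroObject A] [HasBinaryBiproducts A]

/-- The image of a morphism from a projective object. -/
theorem exists_image (hA : IsFinitaryCategory k A) {X : Pres A} {Z : A} (x : Z ⟶ X.tgt) :
    ∃ (W : A) (w : W ⟶ Z) (m : Pres.mk w ⟶ X), Mono m ∧
      point (X := Pres.mk w) (𝟙 Z) ≫ m = point x := by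
  -- `w` generates all morphisms to `Z` that `point x` kills, so the cokernel it presents embeds
  -- into `X`.
  obtain ⟨W, w, ⟨l, hl⟩, h⟩ := exists_generator hA (B := Z)
    (fun V v => ∃ ξ : V ⟶ X.src, v ≫ x = ξ ≫ X.hom) (fun V => ⟨0, by simp⟩)
    (fun V v v' ⟨ξ, hξ⟩ ⟨ξ', hξ'⟩ => ⟨ξ + ξ', by simp [hξ, hξ']⟩)
    (fun V V' a v ⟨ξ, hξ⟩ => ⟨a ≫ ξ, by simp [hξ]⟩)
  refine ⟨W, w, cls ⟨l, x, hl⟩, mono_of_point fun V v hv => ?_, ?_⟩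
  · rw [point_comp_cls, point_eq_zero_iff] at hv
    obtain ⟨y, hy⟩ := h v hv
    exact (point_eq_zero_iff _).2 ⟨y, hy.symm⟩
  · rw [point_comp_cls, Category.id_comp]

theorem surj_of_simple (hA : IsFinitaryCategory k A) {X : Pres A} [Simple X] {Z : A}
    {x : Z ⟶ X.tgt} (hx : point x ≠ 0) : Surj (point x) := by
  obtain ⟨W, w, m, hm, h⟩ := exists_image hA x
  refine surj_of_isIso_image (isIso_of_mono_of_nonzero ?_) h
  rintro rfl
  rw [comp_zero] at h
  exact hx h.symm

/-- The projective object attached to an indecomposable object has a simple top. -/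
theorem exists_simple_top (hA : IsFinitaryCategory k A) {G : A} (hG : Indecomposable G) :
    ∃ (W : A) (ρ : W ⟶ G), Simple (Pres.mk ρ) ∧ (∀ ξ : G ⟶ W, ξ ≫ ρ ≠ 𝟙 G) ∧
      ∀ (X : A) (x : X ⟶ G), (∀ ξ : G ⟶ X, ξ ≫ x ≠ 𝟙 G) → ∃ y : X ⟶ W, y ≫ ρ = x := by
  have split : ∀ {X : A} (x : X ⟶ G) (ξ : G ⟶ X), IsIso (ξ ≫ x) → ∃ ξ : G ⟶ X, ξ ≫ x = 𝟙 G :=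
    fun x ξ _ => ⟨inv (ξ ≫ x) ≫ ξ, by simp⟩
  -- `ρ` generates the radical of `G`, that is, the morphisms to `G` that are not split
  -- epimorphisms. They are closed under addition because the endomorphism ring of `G` is local.
  obtain ⟨W, ρ, hρ, h⟩ := exists_generator hA (B := G)
    (fun X x => ∀ ξ : G ⟶ X, ξ ≫ x ≠ 𝟙 G)
    (fun X ξ hξ => hG.1 ((IsZero.iff_id_eq_zero _).2 (by rw [← hξ, comp_zero])))
    (fun X x y hx hy ξ hξ => by
      rcases Indecomposable.isIso_or_isIso_id_sub hA hG (ξ ≫ x) with h | h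
      · obtain ⟨ζ, hζ⟩ := split x ξ h
        exact hx ζ hζ
      · rw [← hξ, Preadditive.comp_add, add_sub_cancel_left] at h
        obtain ⟨ζ, hζ⟩ := split y ξ h
        exact hy ζ hζ)
    (fun X Y a x hx ξ hξ => hx (ξ ≫ a) (by rw [Category.assoc, hξ]))
  refine ⟨W, ρ, ⟨fun {Y} f _ => ⟨?_, ?_⟩⟩, hρ, fun X x => h x⟩
  · rintro hf rfl
    have h0 : IsZero (Pres.mk ρ) := by
      rw [IsZero.iff_id_eq_zero, ← IsIso.inv_hom_id (0 : Y ⟶ Pres.mk ρ), comp_zero]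
    obtain ⟨ξ, hξ⟩ := (isZero_iff _).1 h0
    exact hρ ξ hξ
  · intro hf
    obtain ⟨s, rfl⟩ := cls_surj f
    -- For a monomorphism into the top there are two cases: its right component splits and it is an
    -- isomorphism, or this component factors through `ρ` and the monomorphism is zero.
    by_cases hs : ∃ u : G ⟶ Y.tgt, u ≫ s.right = 𝟙 G
    · obtain ⟨u, hu⟩ := hs
      -- The monomorphism kills this point, so it vanishes; its null-homotopy completes `u` to a
      -- square, which is a section.
      have h0 : point (ρ ≫ u) = (0 : free W ⟶ Y) := by
        rw [← cancel_mono (cls s), zero_comp, point_comp_cls, Category.assoc, hu,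
          Category.comp_id]
        exact point_self (Pres.mk ρ)
      obtain ⟨η, hη⟩ := (point_eq_zero_iff _).1 h0
      have hsplit : cls (X := Pres.mk ρ) ⟨η, u, hη⟩ ≫ cls s = 𝟙 _ :=
        cls_congr (f := Square.comp _ _) (g := Square.id _) hu
      have : IsSplitEpi (cls s) := ⟨⟨_, hsplit⟩⟩
      exact isIso_of_mono_of_isSplitEpi _
    · push Not at hs
      obtain ⟨y, hy⟩ := h _ hs
      exact absurd ((cls_eq_zero_iff _).2 ⟨y, hy.symm⟩) hf

end Finitary

end Pres

/-! ### Adjunctions, the involution, and direct summands. -/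

section Adjoints

variable {C : Type u} [Bicategory.{w, v} C]

/-- The right adjoint in an adjunction may be replaced by an isomorphic 1-morphism. -/
def adjunctionOfIsoRight {i j : C} {F : i ⟶ j} {G G' : j ⟶ i} (adj : Bicategory.Adjunction F G)
    (e : G ≅ G') : Bicategory.Adjunction F G' where
  unit := adj.unit ≫ F ◁ e.hom
  counit := e.inv ▷ F ≫ adj.counit
  left_triangle := by
    calc
      _ = 𝟙 _ ⊗≫ adj.unit ▷ F ⊗≫ F ◁ (e.hom ≫ e.inv) ▷ F ⊗≫ F ◁ adj.counit ⊗≫ 𝟙 _ := by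
        bicategory
      _ = 𝟙 _ ⊗≫ Bicategory.leftZigzag adj.unit adj.counit ⊗≫ 𝟙 _ := by
        rw [e.hom_inv_id]
        bicategory
      _ = _ := by
        rw [adj.left_triangle]
        bicategory
  right_triangle := by
    calc
      _ = 𝟙 _ ⊗≫ G' ◁ adj.unit ⊗≫ (G' ◁ F ◁ e.hom ≫ e.inv ▷ (F ≫ G')) ⊗≫
          adj.counit ▷ G' ⊗≫ 𝟙 _ := by
        bicategory
      _ = 𝟙 _ ⊗≫ (G' ◁ adj.unit ≫ e.inv ▷ (F ≫ G)) ⊗≫ ((G ≫ F) ◁ e.hom ≫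
          adj.counit ▷ G') ⊗≫ 𝟙 _ := by
        rw [Bicategory.whisker_exchange]
        bicategory
      _ = 𝟙 _ ⊗≫ e.inv ⊗≫ Bicategory.rightZigzag adj.unit adj.counit ⊗≫ e.hom ⊗≫ 𝟙 _ := by
        rw [Bicategory.whisker_exchange, Bicategory.whisker_exchange]
        bicategory
      _ = 𝟙 _ ⊗≫ (e.inv ≫ e.hom) ⊗≫ 𝟙 _ := by
        rw [adj.right_triangle]
        bicategory
      _ = _ := by
        rw [e.inv_hom_id]
        bicategory

theorem homEquiv₂_comp {a b c : C} {l : b ⟶ c} {r : c ⟶ b} (adj : Bicategory.Adjunction l r)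
    {g : a ⟶ b} {h h' : a ⟶ c} (x : g ≫ l ⟶ h) (y : h ⟶ h') :
    adj.homEquiv₂ (x ≫ y) = adj.homEquiv₂ x ≫ y ▷ r := by
  simp [Bicategory.Adjunction.homEquiv₂_apply]

theorem homEquiv₂_symm_comp {a b c : C} {l : b ⟶ c} {r : c ⟶ b} (adj : Bicategory.Adjunction l r)
    {g : a ⟶ b} {h h' : a ⟶ c} (x : g ⟶ h ≫ r) (y : h ⟶ h') :
    adj.homEquiv₂.symm (x ≫ y ▷ r) = adj.homEquiv₂.symm x ≫ y := by
  rw [Equiv.symm_apply_eq, homEquiv₂_comp, Equiv.apply_symm_apply]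

end Adjoints

section Involution

variable {C : Type u} [Bicategory.{w, v} C] (I : Involution C)

namespace Involution

/-- An involution sends direct summands to direct summands. -/
def starRetract {i j : C} {F G : i ⟶ j} (r : Retract F G) : Retract (I.star F) (I.star G) where
  i := I.star₂ r.r
  r := I.star₂ r.i
  retract := by rw [← I.star₂_comp, r.retract, I.star₂_id]

end Involution

/-- Left composition of a direct summand. -/
def retractWhiskerLeft {i j l : C} (H : i ⟶ j) {F G : j ⟶ l} (r : Retract F G) :
    Retract (H ≫ F) (H ≫ G) where
  i := H ◁ r.i
  r := H ◁ r.r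
  retract := by rw [← Bicategory.whiskerLeft_comp, r.retract, Bicategory.whiskerLeft_id]

/-- Right composition of a direct summand. -/
def retractWhiskerRight {i j l : C} {F G : i ⟶ j} (r : Retract F G) (H : j ⟶ l) :
    Retract (F ≫ H) (G ≫ H) where
  i := r.i ▷ H
  r := r.r ▷ H
  retract := by rw [← Bicategory.comp_whiskerRight, r.retract, Bicategory.id_whiskerRight]

/-- The composite of `ξ`, `u ▷ A` and `(g ≫ f) ▷ A` is the identity of `𝟙 i ≫ A`, and it passes
through `G ≫ A`. -/
theorem isSummand_comp_of_factor {i j : C} {A : i ⟶ j} {K G : i ⟶ i} {f : K ⟶ 𝟙 i} {u : K ⟶ G}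
    {g : G ⟶ K} (hf : u ≫ g ≫ f = f) {ξ : 𝟙 i ≫ A ⟶ K ≫ A} (hξ : ξ ≫ f ▷ A = 𝟙 _) :
    IsSummand A (G ≫ A) := by
  refine ⟨⟨(λ_ A).inv ≫ ξ ≫ u ▷ A, (g ≫ f) ▷ A ≫ (λ_ A).hom, ?_⟩⟩
  have h : (ξ ≫ u ▷ A) ≫ (g ≫ f) ▷ A = 𝟙 (𝟙 i ≫ A) := by
    rw [Category.assoc, ← Bicategory.comp_whiskerRight, hf, hξ]
  rw [Category.assoc, ← Category.assoc _ _ (λ_ A).hom, h, Category.id_comp, Iso.inv_hom_id]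

end Involution

/-! ### Vanishing of the action on an object, expressed by adjunction. -/

section Action

variable {C : Type u} [Bicategory.{w, v} C] [∀ i j : C, Preadditive (i ⟶ j)] [Biadditive C]

theorem whiskerRight_zero {i j l : C} {F G : i ⟶ j} (H : j ⟶ l) : (0 : F ⟶ G) ▷ H = 0 := by
  simpa using sub_whiskerRight (0 : F ⟶ G) 0 H

theorem whiskerLeft_zero {i j l : C} (H : i ⟶ j) {F G : j ⟶ l} : H ◁ (0 : F ⟶ G) = 0 := by
  simpa using whiskerLeft_sub H (0 : F ⟶ G) 0

theorem isZero_presPost_iff {i j l : C} (F : j ⟶ l) (X : Pres (i ⟶ j)) :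
    IsZero ((presPost i F).obj X) ↔ ∃ ξ : X.tgt ≫ F ⟶ X.src ≫ F, ξ ≫ X.hom ▷ F = 𝟙 _ :=
  Pres.isZero_iff _

/-- If `F X ≠ 0`, then the counit gives a nonzero morphism to `X`. -/
theorem exists_point_ne_zero_of_presPost [∀ i j : C, HasZeroObject (i ⟶ j)] {i j l : C} {F : j ⟶ l} {F' : l ⟶ j}
    (adj : Bicategory.Adjunction F' F) {X : Pres (i ⟶ j)}
    (hX : ¬ IsZero ((presPost i F).obj X)) :
    ∃ c : (X.tgt ≫ F) ≫ F' ⟶ X.tgt, Pres.point c ≠ 0 := by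
  refine ⟨adj.homEquiv₂.symm (𝟙 _), fun h => hX ?_⟩
  obtain ⟨ξ, hξ⟩ := (Pres.point_eq_zero_iff _).1 h
  refine (isZero_presPost_iff F X).2 ⟨adj.homEquiv₂ ξ, ?_⟩
  rw [← homEquiv₂_comp, ← hξ, Equiv.apply_symm_apply]

/-- If `F` annihilates the cokernel of `ρ`, then every morphism from an object in the image of
the left adjoint of `F` factors through `ρ`. -/
theorem exists_factor_of_isZero_presPost {i j l : C} {F : j ⟶ l} {F' : l ⟶ j}
    (adj : Bicategory.Adjunction F' F) {X : Pres (i ⟶ j)}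
    (hX : IsZero ((presPost i F).obj X)) {Z : i ⟶ l} (y : Z ≫ F' ⟶ X.tgt) :
    ∃ x : Z ≫ F' ⟶ X.src, x ≫ X.hom = y := by
  obtain ⟨η, hη⟩ := (isZero_presPost_iff F X).1 hX
  refine ⟨adj.homEquiv₂.symm (adj.homEquiv₂ y ≫ η), ?_⟩
  rw [← homEquiv₂_symm_comp, Category.assoc, hη, Category.comp_id, Equiv.symm_apply_apply]

theorem isZero_presPost_comp_iff {i j l m : C} (F : j ⟶ l) (G : l ⟶ m) (X : Pres (i ⟶ j)) :
    IsZero ((presPost i (F ≫ G)).obj X) ↔ IsZero ((presPost i G).obj ((presPost i F).obj X)) :=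
  (Pres.isoMk (X := (presPost i (F ≫ G)).obj X) (Y := (presPost i G).obj ((presPost i F).obj X))
    (α_ X.src F G).symm (α_ X.tgt F G).symm
    (Bicategory.associator_inv_naturality_left _ _ _)).isZero_iff

end Action

section Coker

open Pres

/-- A lift `u` of the generating point of `K` along `point g` satisfies `u ≫ g = 𝟙` up to a morphism
factoring through `K.hom`, which `f` kills. -/
theorem exists_section_of_surj {C : Type u} [Bicategory.{w, v} C] [∀ i j : C, Preadditive (i ⟶ j)]
    [∀ i j : C, HasZeroObject (i ⟶ j)] {i j : C} {K : Pres (i ⟶ j)} {G Z : i ⟶ j} {g : G ⟶ K.tgt}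
    (hg : Surj (point g)) {f : K.tgt ⟶ Z} (hf : K.hom ≫ f = 0) :
    ∃ u : K.tgt ⟶ G, u ≫ g ≫ f = f := by
  obtain ⟨u, hu⟩ : ∃ u : K.tgt ⟶ G, point (u ≫ g) = point (𝟙 K.tgt) := by
    obtain ⟨u, hu⟩ := hg
    exact ⟨u, by rw [← point_comp_point, hu]⟩
  obtain ⟨ζ, hζ⟩ := (point_eq_iff _ _).1 hu
  refine ⟨u, ?_⟩
  have h := congrArg (fun t => t ≫ f) hζ
  simp only [Category.assoc, hf, comp_zero, Preadditive.sub_comp, Category.id_comp] at h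
  exact sub_eq_zero.1 h

variable {C : Type u} [Bicategory.{w, v} C] [∀ i j : C, Preadditive (i ⟶ j)] [Biadditive C]
  [∀ i j : C, HasZeroObject (i ⟶ j)] [∀ i j : C, HasBinaryBiproducts (i ⟶ j)]

/-- A contraction of `A` applied to the cokernel lands in `(K.tgt ⊞ 0) ≫ A`; the zero summand
contributes nothing and is projected away. -/
theorem exists_section_of_isZero_coker {i j l : C} {K : Pres (i ⟶ j)} {Z : i ⟶ j}
    (s : K.Square (free Z)) {A : j ⟶ l} (h : IsZero ((presPost i A).obj (coker s))) :
    ∃ ξ : Z ≫ A ⟶ K.tgt ≫ A, ξ ≫ s.right ▷ A = 𝟙 _ := by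
  obtain ⟨ξ, hξ⟩ : ∃ ξ : Z ≫ A ⟶ (K.tgt ⊞ 0) ≫ A,
    ξ ≫ (biprod.desc s.right (0 : 0 ⟶ Z)) ▷ A = 𝟙 _ := (isZero_presPost_iff A (coker s)).1 h
  refine ⟨ξ ≫ biprod.fst ▷ A, ?_⟩
  rw [Category.assoc, ← Bicategory.comp_whiskerRight, ← hξ]
  congr 2
  ext <;> simp

/-- If the cokernel of a morphism `K ⟶ P_1` is annihilated by `A` and `K` is a quotient of the
projective object attached to `G`, then `A` is a direct summand of `A ∘ G`. -/
theorem isSummand_of_isZero_presPost_coker {i j : C} {A : i ⟶ j} {K T : Pres (i ⟶ i)}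
    {κ : K ⟶ Pres.proj (𝟙 i)} {q : Pres.proj (𝟙 i) ⟶ T} (hκ : IsCoker κ q)
    (hT : IsZero ((presPost i A).obj T)) {G : i ⟶ i} {g : G ⟶ K.tgt} (hg : Surj (point g)) :
    IsSummand A (G ≫ A) := by
  obtain ⟨s, rfl⟩ := cls_surj κ
  obtain ⟨hz, ⟨hlim⟩⟩ := hκ
  obtain ⟨hz', ⟨hlim'⟩⟩ := isCoker_cokerπ s
  have e : T ≅ coker s := hlim.coconePointUniqueUpToIso hlim'
  obtain ⟨ξ, hξ⟩ := exists_section_of_isZero_coker s (hT.of_iso ((presPost i A).mapIso e.symm))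
  obtain ⟨u, hu⟩ := exists_section_of_surj hg (s.comm.trans comp_zero)
  exact isSummand_comp_of_factor hu hξ

end Coker

/-! ### Only 1-morphisms below the cell act nontrivially on the generators $A\,L$. -/

section CellSimple

variable {k : Type v'} [Field k] {C : Type u} [Bicategory.{w, v} C]
  [∀ i j : C, Preadditive (i ⟶ j)] [∀ i j : C, Linear k (i ⟶ j)]
  [∀ i j : C, HasZeroObject (i ⟶ j)] [∀ i j : C, HasBinaryBiproducts (i ⟶ j)]

theorem IsFinitary.isFinitaryCategory [hC : IsFinitary C k] (i j : C) :
    IsFinitaryCategory k (i ⟶ j) where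
  idempotentComplete := hC.idempotentComplete i j
  finiteDimensional := hC.finiteDimensional
  finite_indecomposables := hC.finite_indecomposables i j

variable [IsFinitary C k]

open Pres

/-- If `F` annihilates all simple subquotients of `T`, then `F` annihilates `T`. -/
theorem isZero_presPost_of_simple {i j l : C} {F : j ⟶ l} {F' : l ⟶ j}
    (adj : Bicategory.Adjunction F' F) {T : Pres (i ⟶ j)}
    (hT : ∀ S : Pres (i ⟶ j), Simple S → IsSubquotient S T → IsZero ((presPost i F).obj S)) :
    IsZero ((presPost i F).obj T) := by
  have hA := IsFinitary.isFinitaryCategory (k := k) i j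
  by_contra h
  obtain ⟨c, hc⟩ := exists_point_ne_zero_of_presPost adj h
  obtain ⟨G, r, hG, hr⟩ := exists_indecomposable_retract hA
    (fun X (x : X ⟶ T.tgt) => point x = 0) (fun X => point_zero)
    (fun X x y hx hy => point_add_eq_zero hx hy) (fun X Y a x hx => point_zero_precomp a hx) c hc
  obtain ⟨W, ρ, hS, hρ, hmax⟩ := exists_simple_top hA hG
  obtain ⟨V, v, m, hm, hmv⟩ := exists_image hA (r.i ≫ c)
  -- The relations `v` of the image of this nonzero point cannot split over `G`, so they factor
  -- through `ρ`: the image surjects onto the top of the projective object of `G`, which is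
  -- therefore a simple subquotient of `T`.
  obtain ⟨y, hy⟩ := hmax V v (fun ξ hξ => hr (by
    have e : ξ ≫ v ≫ r.i ≫ c = r.i ≫ c := by rw [← Category.assoc, hξ, Category.id_comp]
    have h := point_precomp ξ (point_precomp v hmv)
    rw [e, Category.comp_id, ← point_comp_point, point_self (Pres.mk v), comp_zero,
      zero_comp] at h
    exact h.symm))
  -- Since `F` kills that simple subquotient, the retraction `r.r` factors through `ρ`. Then `ρ`
  -- would split, a contradiction.
  obtain ⟨x, hx⟩ := exists_factor_of_isZero_presPost adj
    (hT _ hS ⟨Pres.mk v, m, cls ⟨y, 𝟙 G, by simp [hy]⟩, hm,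
      (surj_cls_of_right (X := Pres.mk v) (Y := Pres.mk ρ) (x := 𝟙 G) (Category.comp_id _)).epi⟩)
    r.r
  exact hρ (r.i ≫ x) (by
    have := r.retract
    rw [← hx] at this
    rw [Category.assoc]
    exact this)

/-- If `F` acts nontrivially on a simple quotient of the projective object attached to an
indecomposable `G`, then `G` is a direct summand of a composition ending in the left adjoint
of `F`. -/
theorem exists_retract_of_presPost_simple {i j l : C} {F : j ⟶ l} {F' : l ⟶ j}
    (adj : Bicategory.Adjunction F' F) {L : Pres (i ⟶ j)} [Simple L]
    (hL : ¬ IsZero ((presPost i F).obj L)) {G : i ⟶ j} (hG : Indecomposable G)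
    {g : G ⟶ L.tgt} (hg : point g ≠ 0) : ∃ B : i ⟶ l, IsSummand G (B ≫ F') := by
  have hA := IsFinitary.isFinitaryCategory (k := k) i j
  obtain ⟨c, hc⟩ := exists_point_ne_zero_of_presPost adj hL
  -- Both `point c` and `point g` cover the simple object `L`, so each lifts along the other. The
  -- composite `a ≫ b` preserves `point g`; by locality it is invertible, as otherwise `𝟙 G - a ≫ b`
  -- would be invertible and kill `point g`.
  obtain ⟨a, ha⟩ := (surj_of_simple hA hc).lift g
  obtain ⟨b, hb⟩ := (surj_of_simple hA hg).lift c
  rw [point_comp_point] at ha hb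
  have hab : point ((a ≫ b) ≫ g) = point g := by
    rw [Category.assoc, ← point_comp_point a, hb, point_comp_point, ha]
  refine ⟨L.tgt ≫ F, ?_⟩
  rcases Indecomposable.isIso_or_isIso_id_sub hA hG (a ≫ b) with h | h
  · exact ⟨⟨a, b ≫ inv (a ≫ b), by rw [← Category.assoc, IsIso.hom_inv_id]⟩⟩
  · refine absurd ?_ hg
    have h0 : point ((𝟙 G - a ≫ b) ≫ g) = 0 := by
      rw [Preadditive.sub_comp, Category.id_comp, ← point_eq_iff_sub, hab]
    have h1 := point_zero_precomp (inv (𝟙 G - a ≫ b)) h0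
    rwa [IsIso.inv_hom_id_assoc] at h1

/-- An indecomposable 1-morphism `F` that does not annihilate `A L`, where `A ∈ R` and `L` is the
simple object attached to `R`, satisfies `F ≤_{LR} A`. -/
theorem leLR_of_not_isZero_presPost (I : Involution C)
    (hI : ∀ {i j : C} (F : i ⟶ j), Nonempty (Bicategory.Adjunction F (I.star F)))
    {R : Set (Indec C)} {i j l : C} {L : Pres (i ⟶ i)} (hL : IsCellSimple R i L)
    {A : i ⟶ j} (hA : Indecomposable A) (hAR : (⟨A, hA⟩ : Indec C) ∈ R)
    {F : j ⟶ l} (hF : Indecomposable F)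
    (h : ¬ IsZero ((presPost i F).obj ((presPost i A).obj L))) :
    LeLR (⟨F, hF⟩ : Indec C) ⟨A, hA⟩ := by
  have hK := IsFinitary.isFinitaryCategory (k := k) i i
  have adj : ∀ {i j : C} (F : i ⟶ j), Nonempty (Bicategory.Adjunction (I.star F) F) :=
    fun F => (hI (I.star F)).map fun a => adjunctionOfIsoRight a (I.starStar F)
  obtain ⟨K, T, κ, q, -, hq, hT, ⟨hsimple, t, ht, hrad⟩, hne⟩ := hL
  have hL0 : point (𝟙 L.tgt) ≠ 0 := fun h0 => id_nonzero L
    (point_id_cancel (by rw [Category.comp_id, h0, comp_zero]))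
  obtain ⟨G, r, hG, hr⟩ := exists_indecomposable_retract hK
    (fun X (x : X ⟶ L.tgt) => point x = 0) (fun X => point_zero)
    (fun X x y hx hy => point_add_eq_zero hx hy) (fun X Y a x hx => point_zero_precomp a hx)
    (𝟙 L.tgt) hL0
  rw [Category.comp_id] at hr
  obtain ⟨g, hg⟩ := (surj_of_epi ht).lift r.i
  -- The image of `point g` is a subobject of `K` not killed by the map to the simple top, hence all
  -- of `K`.
  have hgs : Surj (point g) := by
    obtain ⟨W, w, m, hm, hmg⟩ := exists_image hK g
    refine surj_of_isIso_image ?_ hmg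
    by_contra hiso
    apply hr
    rw [← hg, ← hmg, Category.assoc, hrad _ m hm hiso, comp_zero]
  obtain ⟨adjA⟩ := adj A
  have hAT := isZero_presPost_of_simple (k := k) adjA
    (fun S hS hST => hT S hS hST A hA hAR)
  obtain ⟨r₁⟩ := isSummand_of_isZero_presPost_coker hq hAT hgs
  obtain ⟨B₂, ⟨r₂⟩⟩ := exists_retract_of_presPost_simple (k := k) adjA (hne A hA hAR) hG hr
  obtain ⟨adjAF⟩ := adj (A ≫ F)
  obtain ⟨B, ⟨r₃⟩⟩ := exists_retract_of_presPost_simple (k := k) adjAF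
    (fun h0 => h ((isZero_presPost_comp_iff A F L).1 h0)) hG hr
  -- The involution moves `F` out of the adjoint: `G` is a summand of `B ≫ (A ≫ F)*`, so `G*` is one
  -- of `A ≫ F ≫ B*`.
  have r₃' : Retract (I.star G) (A ≫ F ≫ I.star B) :=
    (I.starRetract r₃).trans (Retract.ofIso (I.starComp _ _ ≪≫
      Bicategory.whiskerRightIso (I.starStar (A ≫ F)) _ ≪≫ α_ _ _ _))
  have r₁' : Retract (I.star A) (I.star A ≫ I.star G) :=
    (I.starRetract r₁).trans (Retract.ofIso (I.starComp _ _))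
  have r₄ : Retract (I.star A) (I.star A ≫ A ≫ F ≫ I.star B) :=
    r₁'.trans (retractWhiskerLeft _ r₃')
  -- Chain of summands: `A` in `G ≫ A`, `G` in `B₂ ≫ A*`, `A*` in `A* ≫ G*`, and `G*` in a
  -- composition containing `F`.
  have r₅ : Retract A ((B₂ ≫ I.star A ≫ A ≫ F ≫ I.star B) ≫ A) :=
    r₁.trans (retractWhiskerRight (r₂.trans (retractWhiskerLeft _ r₄)) A)
  exact LeLR.intro hF hA (B₂ ≫ I.star A ≫ A) (I.star B ≫ A)
    ⟨r₅.trans (Retract.ofIso (by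
      exact Bicategory.whiskerRightIso (Bicategory.whiskerLeftIso _ (α_ _ _ _).symm ≪≫
        (α_ _ _ _).symm) A ≪≫ α_ _ _ _ ≪≫ Bicategory.whiskerLeftIso _ (α_ _ _ _)))⟩

end CellSimple

/-! ### The ideal of the cell annihilates the cell 2-representation. -/

section Annihilation

variable {C : Type u} [Bicategory.{w, v} C] [∀ i j : C, Preadditive (i ⟶ j)] [Biadditive C]
  [∀ i j : C, HasZeroObject (i ⟶ j)]

open Pres

/-- In this form vanishing visibly passes to finite sums, summands and quotients, hence from the
generators to all objects they present. -/
theorem isZero_presPost_iff_point {i j l : C} {F : j ⟶ l} {F' : l ⟶ j}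
    (adj : Bicategory.Adjunction F' F) {X : Pres (i ⟶ j)} :
    IsZero ((presPost i F).obj X) ↔ ∀ (Z : i ⟶ l) (y : Z ≫ F' ⟶ X.tgt), point y = 0 := by
  refine ⟨fun h Z y => (point_eq_zero_iff _).2 ?_, fun h => ?_⟩
  · obtain ⟨x, hx⟩ := exists_factor_of_isZero_presPost adj h y
    exact ⟨x, hx.symm⟩
  · by_contra h0
    obtain ⟨c, hc⟩ := exists_point_ne_zero_of_presPost adj h0
    exact hc (h _ c)

theorem isZero_presPost_of_isAddClosure {i j l : C} {F : j ⟶ l} {F' : l ⟶ j}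
    (adj : Bicategory.Adjunction F' F) {S : ObjectProperty (Pres (i ⟶ j))}
    (hS : ∀ Y, S Y → IsZero ((presPost i F).obj Y)) {X : Pres (i ⟶ j)} (hX : IsAddClosure S X) :
    IsZero ((presPost i F).obj X) := by
  obtain ⟨n, Y, b, hY, ⟨hb⟩, ⟨r⟩⟩ := hX
  refine (isZero_presPost_iff_point adj).2 fun Z y => ?_
  have h : point y ≫ r.i = 0 := by
    refine hb.isLimit.hom_ext fun a => ?_
    obtain ⟨z, hz⟩ := point_surj ((point y ≫ r.i) ≫ b.π a.as)
    exact (hz.symm.trans ((isZero_presPost_iff_point adj).1 (hS _ (hY a.as)) Z z)).trans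
      zero_comp.symm
  rw [← Category.comp_id (point y), ← r.retract, ← Category.assoc, h, zero_comp]

theorem IsCoker.epi {A : Type u} [Category.{v} A] [HasZeroMorphisms A] {X Y Z : A} {f : X ⟶ Y}
    {p : Y ⟶ Z} (h : IsCoker f p) : Epi p := by
  obtain ⟨h0, ⟨h⟩⟩ := h
  exact ⟨fun _ _ e => Cofork.IsColimit.hom_ext h e⟩

variable [∀ i j : C, HasBinaryBiproducts (i ⟶ j)]

theorem isZero_presPost_of_cellObj {i j l : C} {F : j ⟶ l} {F' : l ⟶ j}
    (adj : Bicategory.Adjunction F' F) {R : Set (Indec C)}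
    (hR : ∀ Y, cellGen R i j Y → IsZero ((presPost i F).obj Y)) {X : Pres (i ⟶ j)}
    (hX : cellObj R i j X) : IsZero ((presPost i F).obj X) := by
  obtain ⟨X₁, X₀, f, p, -, h₀, hp⟩ := hX
  refine (isZero_presPost_iff_point adj).2 fun Z y => ?_
  obtain ⟨x, hx⟩ := (surj_of_epi hp.epi).lift y
  rw [← hx, (isZero_presPost_iff_point adj).1 (isZero_presPost_of_isAddClosure adj hR h₀) Z x,
    zero_comp]

/-- The 2-morphism `α` acts as zero on `X`. -/
def ActsByZero {i j l : C} {F G : j ⟶ l} (α : F ⟶ G) (X : Pres (i ⟶ j)) : Prop :=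
  ∃ ξ : X.tgt ≫ F ⟶ X.src ≫ G, X.tgt ◁ α = ξ ≫ X.hom ▷ G

end Annihilation

section Annihilation

variable {k : Type v'} [Field k] {C : Type u} [Bicategory.{w, v} C]
  [∀ i j : C, Preadditive (i ⟶ j)] [∀ i j : C, Linear k (i ⟶ j)]
  [∀ i j : C, HasZeroObject (i ⟶ j)] [∀ i j : C, HasBinaryBiproducts (i ⟶ j)] [IsFinitary C k]

/-- Induction over the generation of the ideal. Only the generators `𝟙 F` have content: such an `F`
kills every $A\,L$ with $A\in\mathcal R$, as otherwise $F\le_{LR}A\in\mathcal Q$. -/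
theorem actsByZero_of_cellIdealMem (I : Involution C)
    (hI : ∀ {i j : C} (F : i ⟶ j), Nonempty (Bicategory.Adjunction F (I.star F)))
    {Q R : Set (Indec C)} (hRQ : R ⊆ Q) {i j l : C} {F G : j ⟶ l} {α : F ⟶ G}
    (hα : CellIdealMem Q α) {X : Pres (i ⟶ j)}
    (hX : stablePart (principal i) (cellObj R i) j X) : ActsByZero α X := by
  induction hα with
  | @id_mem j l F hF h =>
    obtain ⟨E, hE, -, hEX⟩ := hX
    obtain ⟨adj⟩ : Nonempty (Bicategory.Adjunction (I.star F) F) :=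
      (hI (I.star F)).map fun a => adjunctionOfIsoRight a (I.starStar F)
    have h0 : IsZero ((presPost i F).obj X) := by
      refine isZero_presPost_of_cellObj adj ?_ (hE j X hEX)
      rintro Y ⟨L, A, hA, hL, hAR, ⟨e⟩⟩
      refine IsZero.of_iso ?_ ((presPost i F).mapIso e)
      by_contra h0
      exact h _ (hRQ hAR) (leLR_of_not_isZero_presPost (k := k) I hI hL hA hAR hF h0)
    obtain ⟨ξ, hξ⟩ := (isZero_presPost_iff F X).1 h0
    exact ⟨ξ, by rw [hξ, Bicategory.whiskerLeft_id]⟩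
  | zero_mem F G => exact ⟨0, by rw [whiskerLeft_zero, zero_comp]⟩
  | add_mem _ _ h₁ h₂ =>
    obtain ⟨ξ, hξ⟩ := h₁ hX
    obtain ⟨ζ, hζ⟩ := h₂ hX
    exact ⟨ξ + ζ, by rw [Biadditive.whiskerLeft_add, hξ, hζ, Preadditive.add_comp]⟩
  | comp_left α _ h =>
    obtain ⟨ξ, hξ⟩ := h hX
    exact ⟨X.tgt ◁ α ≫ ξ, by rw [Bicategory.whiskerLeft_comp, hξ, Category.assoc]⟩
  | comp_right β _ h =>
    obtain ⟨ξ, hξ⟩ := h hX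
    exact ⟨ξ ≫ X.src ◁ β, by
      rw [Bicategory.whiskerLeft_comp, hξ, Category.assoc, Category.assoc,
        Bicategory.whisker_exchange]⟩
  -- The induction hypothesis is applied to the image of `X` under `H`, which is available because
  -- the family of objects is stable.
  | @whiskerLeft j j' l H F G α _ h =>
    obtain ⟨ξ, hξ⟩ : ∃ ξ : (X.tgt ≫ H) ≫ F ⟶ (X.src ≫ H) ≫ G,
      (X.tgt ≫ H) ◁ α = ξ ≫ X.hom ▷ H ▷ G :=
      h (X := (presPost i H).obj X) (isStable_stablePart (principal i) (cellObj R i) H X hX)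
    refine ⟨(α_ X.tgt H F).inv ≫ ξ ≫ (α_ X.src H G).hom, ?_⟩
    have h1 : X.tgt ◁ H ◁ α = (α_ X.tgt H F).inv ≫ (X.tgt ≫ H) ◁ α ≫ (α_ X.tgt H G).hom := by
      simp
    rw [h1, hξ]
    simp
  | @whiskerRight j l' l F G α H _ h =>
    obtain ⟨ξ, hξ⟩ := h hX
    refine ⟨(α_ X.tgt F H).inv ≫ ξ ▷ H ≫ (α_ X.src G H).hom, ?_⟩
    have h1 : X.tgt ◁ α ▷ H = (α_ X.tgt F H).inv ≫ (X.tgt ◁ α) ▷ H ≫ (α_ X.tgt G H).hom := by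
      simp
    rw [h1, hξ]
    simp

end Annihilation

/-! ### The truncated bar complex of `τ : E ⟶ 𝟙 j` and its exactness. -/

section BarMorphisms

variable {C : Type u} [Bicategory.{w, v} C] {j l : C} {E : j ⟶ j} (τ : E ⟶ 𝟙 j) (H : j ⟶ l)

/-- The augmentation of the bar construction. -/
def barAug : E ≫ H ⟶ H := τ ▷ H ≫ (λ_ H).hom

theorem barAug_naturality {H K : j ⟶ l} (x : H ⟶ K) :
    E ◁ x ≫ barAug τ K = barAug τ H ≫ x := by
  simp [barAug, Bicategory.whisker_exchange_assoc]

variable [∀ i j : C, Preadditive (i ⟶ j)]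

/-- The differential of the bar construction. -/
def barDiff : (E ≫ E) ≫ H ⟶ E ≫ H :=
  (τ ▷ E ≫ (λ_ E).hom) ▷ H - (E ◁ τ ≫ (ρ_ E).hom) ▷ H

theorem barDiff_naturality {H K : j ⟶ l} (x : H ⟶ K) :
    (E ≫ E) ◁ x ≫ barDiff τ K = barDiff τ H ≫ E ◁ x := by
  simp only [barDiff, Preadditive.comp_sub, Preadditive.sub_comp, Bicategory.whisker_exchange]

end BarMorphisms

section Bar

variable {C : Type u} [Bicategory.{w, v} C] [∀ i j : C, Preadditive (i ⟶ j)] [Biadditive C]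

open Pres

/-- The transformation from the action of `E` to the identity given by `τ : E ⟶ 𝟙`. -/
def presPostCounit (i : C) {j : C} {E : j ⟶ j} (τ : E ⟶ 𝟙 j) : presPost i E ⟶ 𝟭 (Pres (i ⟶ j)) where
  app X := cls (X := (presPost i E).obj X) ⟨X.src ◁ τ ≫ (ρ_ _).hom, X.tgt ◁ τ ≫ (ρ_ _).hom, by
    change X.hom ▷ E ≫ X.tgt ◁ τ ≫ (ρ_ X.tgt).hom = (X.src ◁ τ ≫ (ρ_ X.src).hom) ≫ X.hom
    rw [← Bicategory.whisker_exchange_assoc, Category.assoc, Bicategory.rightUnitor_naturality]⟩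
  naturality := by
    rintro X Y ⟨f⟩
    refine cls_congr (f := Square.comp _ _) (g := Square.comp _ _) ?_
    change f.right ▷ E ≫ Y.tgt ◁ τ ≫ (ρ_ Y.tgt).hom = (X.tgt ◁ τ ≫ (ρ_ X.tgt).hom) ≫ f.right
    rw [← Bicategory.whisker_exchange_assoc, Category.assoc, Bicategory.rightUnitor_naturality]

/-- `τ : E ⟶ 𝟙` is a split epimorphism at `X`. -/
def SplitAt {i j : C} {E : j ⟶ j} (τ : E ⟶ 𝟙 j) (X : Pres (i ⟶ j)) : Prop :=
  ∃ σ : X ⟶ (presPost i E).obj X, σ ≫ (presPostCounit i τ).app X = 𝟙 X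

theorem SplitAt.of_hom {i j : C} {E E' : j ⟶ j} {τ : E ⟶ 𝟙 j} {τ' : E' ⟶ 𝟙 j} (m : E ⟶ E')
    (hm : m ≫ τ' = τ) {X : Pres (i ⟶ j)} (h : SplitAt τ X) : SplitAt τ' X := by
  obtain ⟨σ, hσ⟩ := h
  refine ⟨σ ≫ (presPost₂ i m).app X, ?_⟩
  rw [Category.assoc, ← hσ]
  congr 1
  refine cls_congr (f := Square.comp _ _) ?_
  change X.tgt ◁ m ≫ X.tgt ◁ τ' ≫ (ρ_ _).hom = X.tgt ◁ τ ≫ (ρ_ _).hom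
  rw [← Bicategory.whiskerLeft_comp_assoc, hm]

theorem SplitAt.of_retract {i j : C} {E : j ⟶ j} {τ : E ⟶ 𝟙 j} {X Y : Pres (i ⟶ j)}
    (r : Retract X Y) (h : SplitAt τ Y) : SplitAt τ X := by
  obtain ⟨σ, hσ⟩ := h
  refine ⟨r.i ≫ σ ≫ (presPost i E).map r.r, ?_⟩
  have := (presPostCounit i τ).naturality r.r
  rw [Functor.id_map] at this
  rw [Category.assoc, Category.assoc, this, reassoc_of% hσ, r.retract]

theorem bicone_desc {A : Type u} [Category.{v} A] [HasZeroMorphisms A] {n : ℕ} {Y : Fin n → A}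
    {b : Bicone Y} (hb : b.IsBilimit) {Z : A} (f : ∀ a, Y a ⟶ Z) :
    ∃ d : b.pt ⟶ Z, ∀ a, b.ι a ≫ d = f a :=
  ⟨hb.isColimit.desc (Cofan.mk _ f), fun a => hb.isColimit.fac (Cofan.mk _ f) ⟨a⟩⟩

theorem bicone_hom_ext {A : Type u} [Category.{v} A] [HasZeroMorphisms A] {n : ℕ} {Y : Fin n → A}
    {b : Bicone Y} (hb : b.IsBilimit) {Z : A} {f g : b.pt ⟶ Z}
    (h : ∀ a, b.ι a ≫ f = b.ι a ≫ g) : f = g :=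
  hb.isColimit.hom_ext fun a => h a.as

theorem SplitAt.of_bicone {i j : C} {E : j ⟶ j} {τ : E ⟶ 𝟙 j} {n : ℕ} {Y : Fin n → Pres (i ⟶ j)}
    {b : Bicone Y} (hb : b.IsBilimit) (h : ∀ a, SplitAt τ (Y a)) : SplitAt τ b.pt := by
  choose σ hσ using h
  obtain ⟨d, hd⟩ := bicone_desc hb fun a => σ a ≫ (presPost i E).map (b.ι a)
  refine ⟨d, bicone_hom_ext hb fun a => ?_⟩
  have := (presPostCounit i τ).naturality (b.ι a)
  rw [Functor.id_map] at this
  rw [reassoc_of% (hd a), this, reassoc_of% (hσ a), Category.comp_id]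

/-- The counit of an adjunction `A ⊣ A'` splits on objects in the image of `A`. -/
theorem splitAt_presPost {i j l : C} {A : j ⟶ l} {A' : l ⟶ j} (adj : Bicategory.Adjunction A A')
    (L : Pres (i ⟶ j)) : SplitAt adj.counit ((presPost i A).obj L) := by
  -- By the left triangle identity, the whiskered unit is a section of the whiskered counit.
  let s : A ⟶ A ≫ A' ≫ A := (λ_ A).inv ≫ adj.unit ▷ A ≫ (α_ _ _ _).hom
  have hs : s ≫ A ◁ adj.counit = (ρ_ A).inv := by
    have h := adj.left_triangle
    have h' : Bicategory.leftZigzag adj.unit adj.counit =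
        adj.unit ▷ A ≫ (α_ _ _ _).hom ≫ A ◁ adj.counit := by
      bicategory
    rw [h'] at h
    simp only [s, Category.assoc, h, Iso.inv_hom_id_assoc]
  refine ⟨cls (X := (presPost i A).obj L) (Y := (presPost i _).obj ((presPost i A).obj L))
    ⟨L.src ◁ s ≫ (α_ _ _ _).inv, L.tgt ◁ s ≫ (α_ _ _ _).inv, ?_⟩, ?_⟩
  · change L.hom ▷ A ≫ L.tgt ◁ s ≫ (α_ _ _ _).inv =
      (L.src ◁ s ≫ (α_ _ _ _).inv) ≫ L.hom ▷ A ▷ (A' ≫ A)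
    rw [← Bicategory.whisker_exchange_assoc, Category.assoc,
      Bicategory.associator_inv_naturality_left]
  · refine cls_congr (f := Square.comp _ _) (g := Square.id _) ?_
    change (L.tgt ◁ s ≫ (α_ _ _ _).inv) ≫ (L.tgt ≫ A) ◁ adj.counit ≫ (ρ_ (L.tgt ≫ A)).hom =
      𝟙 (L.tgt ≫ A)
    calc _ = L.tgt ◁ (s ≫ A ◁ adj.counit) ≫ L.tgt ◁ (ρ_ A).hom := by simp
      _ = _ := by rw [hs]; simp

theorem isCoker_iff {A : Type u} [Category.{v} A] [HasZeroMorphisms A] {X Y Z : A} {f : X ⟶ Y}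
    {p : Y ⟶ Z} : IsCoker f p ↔
      Epi p ∧ f ≫ p = 0 ∧ ∀ {W : A} (g : Y ⟶ W), f ≫ g = 0 → ∃ h : Z ⟶ W, p ≫ h = g := by
  refine ⟨fun h => ⟨h.epi, h.1, fun {W} g hg => ?_⟩, fun ⟨_, h0, h⟩ => ⟨h0, ⟨?_⟩⟩⟩
  · obtain ⟨h0, ⟨h⟩⟩ := h
    exact ⟨_, (CokernelCofork.IsColimit.desc' h g hg).2⟩
  · exact CokernelCofork.IsColimit.ofπ' _ _ fun {W} g hg => ⟨(h g hg).choose, (h g hg).choose_spec⟩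

theorem IsCoker.comp_iso {A : Type u} [Category.{v} A] [HasZeroMorphisms A] {X Y Z Z' : A}
    {f : X ⟶ Y} {p : Y ⟶ Z} (h : IsCoker f p) (e : Z ≅ Z') : IsCoker f (p ≫ e.hom) := by
  obtain ⟨_, h0, h⟩ := isCoker_iff.1 h
  refine isCoker_iff.2 ⟨inferInstance, by rw [reassoc_of% h0, zero_comp], fun g hg => ?_⟩
  obtain ⟨t, ht⟩ := h g hg
  exact ⟨e.inv ≫ t, by simp [ht]⟩

theorem presPost_map_zero {i j l : C} (F : j ⟶ l) (X Y : Pres (i ⟶ j)) :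
    (presPost i F).map (0 : X ⟶ Y) = 0 :=
  cls_congr (whiskerRight_zero (F := X.tgt) (G := Y.tgt) F)

theorem biprod_desc_whiskerRight_comp [∀ i j : C, HasBinaryBiproducts (i ⟶ j)] {i j l : C}
    {F : j ⟶ l} {X Y Z : i ⟶ j} {V W : i ⟶ l} {x : X ⟶ Z} {y : Y ⟶ Z} {t : Z ≫ F ⟶ W} {w : V ⟶ W}
    {ξ : X ≫ F ⟶ V} {ζ : Y ≫ F ⟶ V} (hξ : x ▷ F ≫ t = ξ ≫ w) (hζ : y ▷ F ≫ t = ζ ≫ w) :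
    (biprod.desc x y) ▷ F ≫ t = (biprod.fst ▷ F ≫ ξ + biprod.snd ▷ F ≫ ζ) ≫ w := by
  rw [biprod.desc_eq, Biadditive.add_whiskerRight, Preadditive.add_comp, Preadditive.add_comp,
    Bicategory.comp_whiskerRight, Bicategory.comp_whiskerRight, Category.assoc, Category.assoc,
    hξ, hζ, Category.assoc, Category.assoc]

/-- The action of a 1-morphism is right exact. -/
theorem isCoker_presPost [∀ i j : C, HasZeroObject (i ⟶ j)] [∀ i j : C, HasBinaryBiproducts (i ⟶ j)]
    {i j l : C} (F : j ⟶ l) {X Y Z : Pres (i ⟶ j)} {f : X ⟶ Y} {p : Y ⟶ Z} (h : IsCoker f p) :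
    IsCoker ((presPost i F).map f) ((presPost i F).map p) := by
  obtain ⟨s, rfl⟩ := cls_surj f
  have h0 := h.1
  obtain ⟨⟨hlim⟩, hz, ⟨hlim'⟩⟩ := And.intro h.2 (isCoker_cokerπ s)
  let e : coker s ≅ Z := hlim'.coconePointUniqueUpToIso hlim
  have he : cokerπ s ≫ e.hom = p :=
    hlim'.comp_coconePointUniqueUpToIso_hom hlim WalkingParallelPair.one
  have hF : IsCoker ((presPost i F).map (cls s)) ((presPost i F).map (cokerπ s)) := by
    refine isCoker_iff.2 ⟨Surj.epi ⟨𝟙 _, ?_⟩, ?_, fun {W} g hg => ?_⟩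
    · change cls (Square.comp _ _) = cls _
      refine cls_congr ?_
      change 𝟙 _ ≫ (𝟙 Y.tgt) ▷ F = 𝟙 _
      rw [Bicategory.id_whiskerRight]
      exact Category.comp_id _
    · rw [← Functor.map_comp, hz, presPost_map_zero]
    · obtain ⟨t, rfl⟩ := cls_surj g
      obtain ⟨ξ, hξ⟩ : ∃ ξ : X.tgt ≫ F ⟶ W.src, s.right ▷ F ≫ t.right = ξ ≫ W.hom :=
        (cls_eq_zero_iff (Square.comp _ _)).1 hg
      have ht : Y.hom ▷ F ≫ t.right = t.left ≫ W.hom := t.comm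
      refine ⟨cls (X := (presPost i F).obj (coker s))
        ⟨biprod.fst ▷ F ≫ ξ + biprod.snd ▷ F ≫ t.left, t.right, ?_⟩, ?_⟩
      · exact biprod_desc_whiskerRight_comp hξ ht
      · refine cls_congr (f := Square.comp _ _) ?_
        change (𝟙 Y.tgt) ▷ F ≫ t.right = t.right
        rw [Bicategory.id_whiskerRight]
        exact Category.id_comp _
  rw [← he, Functor.map_comp]
  exact hF.comp_iso ((presPost i F).mapIso e)

/-- Only zero morphisms are at hand in `Pres`, so differences are formed among 2-morphisms. This
translates being killed by `barDiff` into coequalizing its two faces. -/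
theorem presPost₂_sub_comp_eq_zero_iff {i j l : C} {F G : j ⟶ l} (a b : F ⟶ G)
    {X : Pres (i ⟶ j)} {Y : Pres (i ⟶ l)} (g : (presPost i G).obj X ⟶ Y) :
    (presPost₂ i (a - b)).app X ≫ g = 0 ↔
      (presPost₂ i a).app X ≫ g = (presPost₂ i b).app X ≫ g := by
  obtain ⟨s, rfl⟩ := cls_surj g
  have h1 : (presPost₂ i (a - b)).app X ≫ cls s = 0 ↔ ∃ ξ : X.tgt ≫ F ⟶ Y.src,
    X.tgt ◁ (a - b) ≫ s.right = ξ ≫ Y.hom := cls_eq_zero_iff (Square.comp _ _)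
  have h2 : (presPost₂ i a).app X ≫ cls s = (presPost₂ i b).app X ≫ cls s ↔
    ∃ ξ : X.tgt ≫ F ⟶ Y.src, X.tgt ◁ a ≫ s.right - X.tgt ◁ b ≫ s.right = ξ ≫ Y.hom :=
      cls_eq_iff (Square.comp _ _) (Square.comp _ _)
  have h3 : ∀ t : X.tgt ≫ G ⟶ Y.tgt,
      X.tgt ◁ (a - b) ≫ t = X.tgt ◁ a ≫ t - X.tgt ◁ b ≫ t := fun t => by
    rw [whiskerLeft_sub, Preadditive.sub_comp]
  rw [h1, h2]
  exact exists_congr fun ξ => Eq.congr_left (h3 s.right)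

section

variable {j l : C} {E : j ⟶ j} (τ : E ⟶ 𝟙 j) (H : j ⟶ l)

variable {i : C} (X : Pres (i ⟶ j))

/-- The action of a composition. -/
def presPostComp (F : j ⟶ l) {m : C} (G : l ⟶ m) :
    (presPost i G).obj ((presPost i F).obj X) ≅ (presPost i (F ≫ G)).obj X :=
  Pres.isoMk (X := (presPost i G).obj ((presPost i F).obj X)) (Y := (presPost i (F ≫ G)).obj X)
    (α_ X.src F G) (α_ X.tgt F G) (Bicategory.associator_naturality_left _ _ _)

theorem presPostComp_barAug :
    (presPostComp X E H).hom ≫ (presPost₂ i (barAug τ H)).app X =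
      (presPost i H).map ((presPostCounit i τ).app X) := by
  refine cls_congr (f := Square.comp _ _) ?_
  change (α_ X.tgt E H).hom ≫ X.tgt ◁ (τ ▷ H ≫ (λ_ H).hom) = (X.tgt ◁ τ ≫ (ρ_ X.tgt).hom) ▷ H
  simp

/-- The associativity isomorphism for the action of `E ≫ E ≫ H`. -/
def presPostComp₂ :
    (presPost i (E ≫ H)).obj ((presPost i E).obj X) ≅ (presPost i ((E ≫ E) ≫ H)).obj X :=
  presPostComp X E (E ≫ H) ≪≫ Pres.isoMk (X := (presPost i (E ≫ (E ≫ H))).obj X)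
    (Y := (presPost i ((E ≫ E) ≫ H)).obj X) (Bicategory.whiskerLeftIso _ (α_ _ _ _).symm)
    (Bicategory.whiskerLeftIso _ (α_ _ _ _).symm) (Bicategory.whisker_exchange _ _).symm

/-- The first face of the bar complex contracts the copy of `E` acting first, and so comes from the
counit at `X`. -/
theorem presPostComp₂_left :
    (presPostComp₂ H X).hom ≫ (presPost₂ i ((τ ▷ E ≫ (λ_ E).hom) ▷ H)).app X =
      (presPost i (E ≫ H)).map ((presPostCounit i τ).app X) := by
  refine cls_congr (f := Square.comp (Square.comp _ _) _) ?_
  change ((α_ X.tgt E (E ≫ H)).hom ≫ X.tgt ◁ (α_ E E H).inv) ≫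
    X.tgt ◁ (τ ▷ E ≫ (λ_ E).hom) ▷ H = (X.tgt ◁ τ ≫ (ρ_ X.tgt).hom) ▷ (E ≫ H)
  simp

/-- The second face contracts the copy of `E` acting last: it is the augmentation at the image of
`X` under `E`. -/
theorem presPostComp₂_right :
    (presPostComp₂ H X).hom ≫ (presPost₂ i ((E ◁ τ ≫ (ρ_ E).hom) ▷ H)).app X =
      (presPost₂ i (barAug τ H)).app ((presPost i E).obj X) ≫ (presPostComp X E H).hom := by
  refine cls_congr (f := Square.comp (Square.comp _ _) _) (g := Square.comp _ _) ?_
  change ((α_ X.tgt E (E ≫ H)).hom ≫ X.tgt ◁ (α_ E E H).inv) ≫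
    X.tgt ◁ (E ◁ τ ≫ (ρ_ E).hom) ▷ H = (X.tgt ≫ E) ◁ (τ ▷ H ≫ (λ_ H).hom) ≫ (α_ X.tgt E H).hom
  simp

/-- The bar construction is exact at objects where the augmentation splits. -/
theorem isCoker_barDiff_of_splitAt {X : Pres (i ⟶ j)} (hX : SplitAt τ X) :
    IsCoker ((presPost₂ i (barDiff τ H)).app X) ((presPost₂ i (barAug τ H)).app X) := by
  obtain ⟨σ, hσ⟩ := hX
  -- The section `σ` turns the bar complex at `X` into a split coequalizer: it splits the
  -- augmentation and, by naturality, produces the factorization of any `g` that coequalizes the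
  -- faces.
  have hs : ((presPost i H).map σ ≫ (presPostComp X E H).hom) ≫
      (presPost₂ i (barAug τ H)).app X = 𝟙 _ := by
    rw [Category.assoc, presPostComp_barAug, ← Functor.map_comp, hσ, CategoryTheory.Functor.map_id]
  have : IsSplitEpi ((presPost₂ i (barAug τ H)).app X) := ⟨⟨_, hs⟩⟩
  have hab : ∀ {Y : Pres (i ⟶ l)} (g : (presPost i (E ≫ H)).obj X ⟶ Y),
      (presPost₂ i (barDiff τ H)).app X ≫ g = 0 ↔
        (presPost i (E ≫ H)).map ((presPostCounit i τ).app X) ≫ g =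
          (presPost₂ i (barAug τ H)).app ((presPost i E).obj X) ≫ (presPostComp X E H).hom ≫ g := by
    intro Y g
    rw [barDiff, presPost₂_sub_comp_eq_zero_iff, ← cancel_epi (presPostComp₂ H X).hom,
      ← Category.assoc, ← Category.assoc, presPostComp₂_left, presPostComp₂_right, Category.assoc]
  refine isCoker_iff.2 ⟨inferInstance, ?_, fun g hg => ?_⟩
  · rw [hab, presPostComp_barAug]
    exact (presPost₂ i (barAug τ H)).naturality ((presPostCounit i τ).app X)
  · rw [hab] at hg
    refine ⟨((presPost i H).map σ ≫ (presPostComp X E H).hom) ≫ g, ?_⟩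
    have hnat := (presPost₂ i (barAug τ H)).naturality σ
    rw [Category.assoc, ← Category.assoc, ← hnat, Category.assoc, ← hg, ← Category.assoc,
      ← Functor.map_comp, hσ, CategoryTheory.Functor.map_id, Category.id_comp]

/-- Exactness of the bar construction passes to cokernels. -/
theorem isCoker_barDiff_of_isCoker [∀ i j : C, HasZeroObject (i ⟶ j)]
    [∀ i j : C, HasBinaryBiproducts (i ⟶ j)] {X₁ X₀ X : Pres (i ⟶ j)} {f : X₁ ⟶ X₀} {p : X₀ ⟶ X}
    (hp : IsCoker f p) (h₁ : SplitAt τ X₁) (h₀ : SplitAt τ X₀) :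
    IsCoker ((presPost₂ i (barDiff τ H)).app X) ((presPost₂ i (barAug τ H)).app X) := by
  -- At `X₁` only surjectivity of the augmentation is needed, to see that the morphism found over
  -- `X₀` kills the image of `f`.
  obtain ⟨_, -, -⟩ := isCoker_iff.1 (isCoker_barDiff_of_splitAt τ H h₁)
  obtain ⟨_, hz, hc⟩ := isCoker_iff.1 (isCoker_barDiff_of_splitAt τ H h₀)
  obtain ⟨_, hpz, hpc⟩ := isCoker_iff.1 (isCoker_presPost H hp)
  have := (isCoker_presPost (E ≫ H) hp).epi
  have := (isCoker_presPost ((E ≫ E) ≫ H) hp).epi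
  have naug := fun {U V : Pres (i ⟶ j)} (x : U ⟶ V) => (presPost₂ i (barAug τ H)).naturality x
  have ndiff := fun {U V : Pres (i ⟶ j)} (x : U ⟶ V) => (presPost₂ i (barDiff τ H)).naturality x
  refine isCoker_iff.2 ⟨?_, ?_, fun g hg => ?_⟩
  · have h : Epi ((presPost i (E ≫ H)).map p ≫ (presPost₂ i (barAug τ H)).app X) := by
      rw [naug]
      infer_instance
    exact epi_of_epi ((presPost i (E ≫ H)).map p) _
  · rw [← cancel_epi ((presPost i ((E ≫ E) ≫ H)).map p), ← Category.assoc, ndiff, Category.assoc,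
      naug, reassoc_of% hz, zero_comp, comp_zero]
  · obtain ⟨t, ht⟩ := hc ((presPost i (E ≫ H)).map p ≫ g) (by
      rw [← Category.assoc, ← ndiff, Category.assoc, hg, comp_zero])
    obtain ⟨t', ht'⟩ := hpc t (by
      rw [← cancel_epi ((presPost₂ i (barAug τ H)).app X₁), ← Category.assoc, ← naug,
        Category.assoc, ht, ← Category.assoc, ← Functor.map_comp, hp.1, presPost_map_zero,
        zero_comp, comp_zero])
    refine ⟨t', ?_⟩
    rw [← cancel_epi ((presPost i (E ≫ H)).map p), ← Category.assoc, naug, Category.assoc, ht', ht]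

end

end Bar

/-! ### Which 1-morphisms belong to $\mathcal C_{\mathcal Q}$, and the choice of `E`. -/

section LeLR

variable {C : Type u} [Bicategory.{w, v} C] [∀ i j : C, Preadditive (i ⟶ j)]
  [∀ i j : C, HasBinaryBiproducts (i ⟶ j)]

theorem LeLR.trans {F G H : Indec C} (h : LeLR F G) (h' : LeLR G H) : LeLR F H := by
  obtain ⟨hF, hG, A, B, ⟨r⟩⟩ := h
  obtain ⟨_, hH, A', B', ⟨r'⟩⟩ := h'
  exact LeLR.intro hF hH (A' ≫ A) (B ≫ B')
    ⟨r'.trans ((retractWhiskerLeft A' (retractWhiskerRight r B')).trans (Retract.ofIso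
      (Bicategory.whiskerLeftIso A' (α_ _ _ _ ≪≫ Bicategory.whiskerLeftIso A (α_ _ _ _)) ≪≫
        (α_ _ _ _).symm)))⟩

theorem LeLR.of_retract {i j l m : C} {A : j ⟶ l} (hA : Indecomposable A) {B : i ⟶ j} {F : l ⟶ m}
    {G : i ⟶ m} (hG : Indecomposable G) (r : Retract G ((B ≫ A) ≫ F)) :
    LeLR (⟨A, hA⟩ : Indec C) ⟨G, hG⟩ :=
  LeLR.intro hA hG B F ⟨r.trans (Retract.ofIso (α_ _ _ _))⟩

end LeLR

section CellSub

variable {C : Type u} [Bicategory.{w, v} C] [∀ i j : C, Preadditive (i ⟶ j)]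
  [∀ i j : C, HasBinaryBiproducts (i ⟶ j)]
  [Biadditive C]

/-- A 1-morphism of `C`, viewed as a 1-morphism of `C / I_Q`. -/
abbrev quoHom (Q : Set (Indec C)) {i j : C} (F : i ⟶ j) :
    (⟨i⟩ : (cellIdeal Q).Quo) ⟶ ⟨j⟩ :=
  (⟨F⟩ : TwoIdeal.Quo.Hom (I := cellIdeal Q) ⟨i⟩ ⟨j⟩)

/-- Direct summands in `C` remain direct summands in `C / I_Q`. -/
def quoRetract (Q : Set (Indec C)) {i j : C} {F G : i ⟶ j} (r : Retract F G) :
    Retract (quoHom Q F) (quoHom Q G) where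
  i := TwoIdeal.Quo.cls (F := ⟨F⟩) (G := ⟨G⟩) r.i
  r := TwoIdeal.Quo.cls (F := ⟨G⟩) (G := ⟨F⟩) r.r
  retract := congrArg (Quotient.mk _) r.retract

theorem isZero_quoHom {Q : Set (Indec C)} {i j : C} {F : i ⟶ j} (h : CellIdealMem Q (𝟙 F)) :
    IsZero (quoHom Q F) where
  unique_to G := ⟨⟨⟨TwoIdeal.Quo.cls (F := ⟨F⟩) (G := G) 0⟩, by
    rintro ⟨α⟩
    refine (TwoIdeal.Quo.cls_eq_iff (F := ⟨F⟩) (G := G) α 0).2 ?_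
    have := CellIdealMem.comp_right α h
    rw [Category.id_comp] at this
    rwa [sub_zero]⟩⟩
  unique_from G := ⟨⟨⟨TwoIdeal.Quo.cls (F := G) (G := ⟨F⟩) 0⟩, by
    rintro ⟨α⟩
    refine (TwoIdeal.Quo.cls_eq_iff (F := G) (G := ⟨F⟩) α 0).2 ?_
    have := CellIdealMem.comp_left α h
    rw [Category.comp_id] at this
    rwa [sub_zero]⟩⟩

/-- All compositions starting with `E` belong to `C_Q`. -/
def CompMemCellSub (Q : Set (Indec C)) {i j : C} (E : i ⟶ j) : Prop :=
  ∀ {l : C} (F : j ⟶ l), CellSubMem Q (quoHom Q (E ≫ F))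

theorem compMemCellSub_zero [∀ i j : C, HasZeroObject (i ⟶ j)] (Q : Set (Indec C)) (i j : C) : CompMemCellSub Q (0 : i ⟶ j) := by
  intro l F
  refine .zero_mem _ (isZero_quoHom ?_)
  rw [← Bicategory.id_whiskerRight, (isZero_zero (i ⟶ j)).eq_zero_of_src (𝟙 0)]
  exact .whiskerRight F (.zero_mem _ _)

theorem CompMemCellSub.biprod {Q : Set (Indec C)} {i j : C} {E E' : i ⟶ j}
    (h : CompMemCellSub Q E) (h' : CompMemCellSub Q E') : CompMemCellSub Q (E ⊞ E') := by
  intro l F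
  refine .summand_mem ⟨quoRetract Q (G := (E ≫ F) ⊞ (E' ≫ F))
    ⟨biprod.lift (biprod.fst ▷ F) (biprod.snd ▷ F), biprod.desc (biprod.inl ▷ F) (biprod.inr ▷ F),
      ?_⟩⟩ (.biprod_mem (h F) (h' F))
  rw [biprod.lift_desc, ← Bicategory.comp_whiskerRight, ← Bicategory.comp_whiskerRight,
    ← Biadditive.add_whiskerRight, biprod.total, Bicategory.id_whiskerRight]

end CellSub

section CellSub

variable {k : Type v'} [Field k] {C : Type u} [Bicategory.{w, v} C]
  [∀ i j : C, Preadditive (i ⟶ j)] [∀ i j : C, Linear k (i ⟶ j)]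
  [∀ i j : C, HasZeroObject (i ⟶ j)] [∀ i j : C, HasBinaryBiproducts (i ⟶ j)] [IsFinitary C k]

/-- Compositions with an element of `Q` in the middle belong to `C_Q`. -/
theorem cellSubMem_of_mem {Q : Set (Indec C)} (hQ : IsTwoSidedCell Q) {i j l m : C} {A : j ⟶ l}
    (hA : Indecomposable A) (hAQ : (⟨A, hA⟩ : Indec C) ∈ Q) (B : i ⟶ j) (F : l ⟶ m) :
    CellSubMem Q (quoHom Q ((B ≫ A) ≫ F)) := by
  have hK := IsFinitary.isFinitaryCategory (k := k) i m
  -- The condition on indecomposable summands is inherited by summands of `H`, so the decomposition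
  -- of `H` can be handled by induction.
  suffices h : ∀ H : i ⟶ m, (∀ (G : i ⟶ m) (hG : Indecomposable G), Nonempty (Retract G H) →
      LeLR (⟨A, hA⟩ : Indec C) ⟨G, hG⟩) → CellSubMem Q (quoHom Q H) from
    h _ fun G hG ⟨r⟩ => LeLR.of_retract hA hG r
  refine indecomposable_induction hK ?_ ?_ ?_ ?_
  · intro H hH _
    refine .zero_mem _ (isZero_quoHom ?_)
    rw [hH.eq_zero_of_src (𝟙 H)]
    exact .zero_mem _ _
  · intro H hH h
    have hAH := h H hH ⟨Retract.refl H⟩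
    -- If `H` lies below some element of `Q`, then being above `A` puts it in `Q`. Otherwise `𝟙 H`
    -- generates part of the ideal and `H` is zero in the quotient.
    by_cases hHQ : ∃ G ∈ Q, LeLR (⟨H, hH⟩ : Indec C) G
    · obtain ⟨G, hG, hHG⟩ := hHQ
      refine .cell_mem _ hH ?_
      obtain ⟨F₀, rfl⟩ := hQ
      exact ⟨hAQ.1.trans hAH, hHG.trans hG.2⟩
    · push Not at hHQ
      exact .zero_mem _ (isZero_quoHom (.id_mem H hH hHQ))
  · intro Y Z hY hZ h
    exact .biprod_mem
      (hY fun G hG ⟨r⟩ => h G hG ⟨r.trans ⟨biprod.inl, biprod.fst, biprod.inl_fst⟩⟩)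
      (hZ fun G hG ⟨r⟩ => h G hG ⟨r.trans ⟨biprod.inr, biprod.snd, biprod.inr_snd⟩⟩)
  · intro X Y e hY h
    exact .summand_mem ⟨quoRetract Q (Retract.ofIso e)⟩
      (hY fun G hG ⟨r⟩ => h G hG ⟨r.trans (Retract.ofIso e.symm)⟩)

/-- The objects `A L`, `A ∈ R`, in a finite family are simultaneously split by a morphism
`E ⟶ 𝟙`, where `E` is obtained from elements of `Q`. -/
theorem exists_splitAt {Q R : Set (Indec C)} (hQ : IsTwoSidedCell Q) (hRQ : R ⊆ Q)
    (hadj : ∀ {i j : C} (F : i ⟶ j), ∃ F' : j ⟶ i, Nonempty (Bicategory.Adjunction F F'))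
    {i j : C} {n : ℕ} (Y : Fin n → Pres (i ⟶ j)) (hY : ∀ a, cellGen R i j (Y a)) :
    ∃ (E : j ⟶ j) (τ : E ⟶ 𝟙 j), CompMemCellSub Q E ∧ ∀ a, SplitAt τ (Y a) := by
  suffices h : ∀ s : Finset (Fin n), ∃ (E : j ⟶ j) (τ : E ⟶ 𝟙 j), CompMemCellSub Q E ∧
      ∀ a ∈ s, SplitAt τ (Y a) by
    obtain ⟨E, τ, hE, h⟩ := h Finset.univ
    exact ⟨E, τ, hE, fun a => h a (Finset.mem_univ a)⟩
  intro s
  induction s using Finset.induction_on with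
  | empty => exact ⟨0, 0, compMemCellSub_zero Q j j, by simp⟩
  | insert a s _ ih =>
    obtain ⟨E, τ, hE, h⟩ := ih
    obtain ⟨L, A, hA, -, hAR, ⟨e⟩⟩ := hY a
    obtain ⟨A', ⟨adj⟩⟩ := hadj A
    -- The new summand with the counit of `A ⊣ A'` splits at `Y a`; enlarging `E` preserves the
    -- splittings already obtained.
    refine ⟨(A' ≫ A) ⊞ E, biprod.desc adj.counit τ, CompMemCellSub.biprod
      (fun F => cellSubMem_of_mem (k := k) hQ hA (hRQ hAR) A' F) hE, fun b hb => ?_⟩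
    rcases Finset.mem_insert.1 hb with rfl | hb
    · exact ((splitAt_presPost adj L).of_retract (Retract.ofIso e)).of_hom biprod.inl (by simp)
    · exact (h b hb).of_hom biprod.inr (by simp)

/-- The objects of the cell 2-representation are presented by the bar construction of a morphism
`E ⟶ 𝟙`, where `E` is obtained from elements of `Q`. -/
theorem exists_isCoker_barDiff {Q R : Set (Indec C)} (hQ : IsTwoSidedCell Q) (hRQ : R ⊆ Q)
    (hadj : ∀ {i j : C} (F : i ⟶ j), ∃ F' : j ⟶ i, Nonempty (Bicategory.Adjunction F F'))
    {i j : C} {X : Pres (i ⟶ j)} (hX : cellObj R i j X) :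
    ∃ (E : j ⟶ j) (τ : E ⟶ 𝟙 j), CompMemCellSub Q E ∧ ∀ {l : C} (H : j ⟶ l),
      IsCoker ((presPost₂ i (barDiff τ H)).app X) ((presPost₂ i (barAug τ H)).app X) := by
  obtain ⟨X₁, X₀, f, p, ⟨n₁, Y₁, b₁, hY₁, ⟨hb₁⟩, ⟨r₁⟩⟩, ⟨n₀, Y₀, b₀, hY₀, ⟨hb₀⟩, ⟨r₀⟩⟩, hp⟩ := hX
  obtain ⟨E₁, τ₁, hE₁, h₁⟩ := exists_splitAt (k := k) hQ hRQ hadj Y₁ hY₁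
  obtain ⟨E₀, τ₀, hE₀, h₀⟩ := exists_splitAt (k := k) hQ hRQ hadj Y₀ hY₀
  refine ⟨E₁ ⊞ E₀, biprod.desc τ₁ τ₀, hE₁.biprod hE₀, fun H => isCoker_barDiff_of_isCoker _ H hp
    (((SplitAt.of_bicone hb₁ h₁).of_retract r₁).of_hom biprod.inl (by simp))
    (((SplitAt.of_bicone hb₀ h₀).of_retract r₀).of_hom biprod.inr (by simp))⟩

end CellSub

/-! ### Presentations in the image of an evaluation functor. -/

section Evaluation

/-- Two objects of `D` and all morphisms between them have presentations in the image of `Φ`. -/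
def GeneratesAt {A : Type u} [Category.{v} A] {D : Type u'} [Category.{v'} D]
    [HasZeroMorphisms D] (Φ : A ⥤ D) (S : ObjectProperty A) (X Y : D) : Prop :=
  ∃ (α β : Pres A) (p : Φ.obj α.tgt ⟶ X) (q : Φ.obj β.tgt ⟶ Y),
    (S α.src ∧ S α.tgt ∧ S β.src ∧ S β.tgt) ∧
    IsCoker (Φ.map α.hom) p ∧ IsCoker (Φ.map β.hom) q ∧
    ∀ f : X ⟶ Y, ∃ s : α.Square β, Φ.map s.right ≫ q = p ≫ f

/-- The functor evaluating the action on an object. -/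
def evalAt {B : Type u} [Bicategory.{w, v} B] (M : Pseudofunctor B Cat.{w', u'}) {i : B}
    (X : M.obj i) (j : B) : (i ⟶ j) ⥤ M.obj j where
  obj F := (M.map F).toFunctor.obj X
  map α := (M.map₂ α).toNatTrans.app X
  map_id F := by rw [M.map₂_id]; rfl
  map_comp α β := by rw [M.map₂_comp]; rfl

theorem generates_iff {B : Type u} [Bicategory.{w, v} B] (M : Pseudofunctor B Cat.{w', u'})
    [∀ i, HasZeroMorphisms (M.obj i)] {i : B} (X₀ : M.obj i) :
    Generates M X₀ ↔ ∀ (j : B) (X Y : M.obj j), GeneratesAt (evalAt M X₀ j) ⊤ X Y := by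
  refine forall_congr' fun j => forall_congr' fun X => forall_congr' fun Y => ?_
  constructor
  · rintro ⟨α, β, p, q, h⟩
    exact ⟨α, β, p, q, ⟨trivial, trivial, trivial, trivial⟩, h⟩
  · rintro ⟨α, β, p, q, -, h⟩
    exact ⟨α, β, p, q, h⟩

variable {A : Type u} [Category.{v} A] [Preadditive A] [HasBinaryBiproducts A] {D : Type u'}
  [Category.{v'} D] [HasZeroMorphisms D] {Φ : A ⥤ D}

/-- A functor is jointly right exact on biproducts if morphisms out of the value at a biproduct
are determined on the summands. -/
def ReflectsZero (Φ : A ⥤ D) : Prop :=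
  ∀ {U V : A} {Y : D} (g : Φ.obj (U ⊞ V) ⟶ Y), Φ.map biprod.inl ≫ g = 0 →
    Φ.map biprod.inr ≫ g = 0 → g = 0

/-- `D` is not assumed additive: being killed by `Φ.map (biprod.desc a b)` is tested on the two
summands separately. -/
theorem isCoker_map_desc (hΦ : ReflectsZero Φ) {U V W : A} {a : U ⟶ W} {b : V ⟶ W} {X : D}
    {p : Φ.obj W ⟶ X} [Epi p] (ha : Φ.map a ≫ p = 0) (hb : Φ.map b ≫ p = 0)
    (h : ∀ {Y : D} (g : Φ.obj W ⟶ Y), Φ.map a ≫ g = 0 → Φ.map b ≫ g = 0 → ∃ t, p ≫ t = g) :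
    IsCoker (Φ.map (biprod.desc a b)) p := by
  refine isCoker_iff.2 ⟨inferInstance, hΦ _ ?_ ?_, fun g hg => h g ?_ ?_⟩
  · rw [← Category.assoc, ← Φ.map_comp, biprod.inl_desc, ha]
  · rw [← Category.assoc, ← Φ.map_comp, biprod.inr_desc, hb]
  · rw [← biprod.inl_desc a b, Φ.map_comp, Category.assoc, hg, comp_zero]
  · rw [← biprod.inr_desc a b, Φ.map_comp, Category.assoc, hg, comp_zero]

/-- This allows relations acting by zero to be added to a presentation, which absorbs errors lying
in the ideal. -/
theorem isCoker_map_desc_of_map_eq_zero (hΦ : ReflectsZero Φ) {U V W : A} {a : U ⟶ W} {b : V ⟶ W}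
    (hb : Φ.map b = 0) {X : D} {p : Φ.obj W ⟶ X} (hp : IsCoker (Φ.map a) p) :
    IsCoker (Φ.map (biprod.desc a b)) p := by
  obtain ⟨_, h0, h⟩ := isCoker_iff.1 hp
  exact isCoker_map_desc hΦ h0 (by rw [hb, zero_comp]) fun g hg _ => h g hg

end Evaluation

section FullSubcategory

variable {A : Type u} [Category.{v} A] {P : ObjectProperty A}

theorem isEquivalence_ι (hP : ∀ X, P X) : P.ι.IsEquivalence where
  essSurj := ⟨fun X => ⟨⟨X, hP X⟩, ⟨Iso.refl _⟩⟩⟩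

variable [HasZeroMorphisms A]

theorem IsCoker.of_hom {X Y Z : P.FullSubcategory} {f : X ⟶ Y} {p : Y ⟶ Z}
    (h : IsCoker f.hom p.hom) : IsCoker f p := by
  obtain ⟨_, h0, h⟩ := isCoker_iff.1 h
  refine isCoker_iff.2 ⟨⟨fun a b e => ?_⟩, ?_, fun g hg => ?_⟩
  · apply InducedCategory.hom_ext
    rw [← cancel_epi p.hom]
    exact congrArg (·.hom) e
  · exact InducedCategory.hom_ext h0
  · obtain ⟨t, ht⟩ := h g.hom (congrArg (·.hom) hg)
    exact ⟨ObjectProperty.homMk t, InducedCategory.hom_ext ht⟩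

/-- The hypothesis on `P` is what lets the universal property be tested against every object of `A`.
-/
theorem IsCoker.hom (hP : ∀ X, P X) {X Y Z : P.FullSubcategory} {f : X ⟶ Y} {p : Y ⟶ Z}
    (h : IsCoker f p) : IsCoker f.hom p.hom := by
  obtain ⟨_, h0, h⟩ := isCoker_iff.1 h
  refine isCoker_iff.2 ⟨⟨fun {W} a b e => ?_⟩, congrArg (·.hom) h0, fun {W} g hg => ?_⟩
  · have : (ObjectProperty.homMk a : Z ⟶ ⟨W, hP W⟩) = ObjectProperty.homMk b := by
      rw [← cancel_epi p]
      exact InducedCategory.hom_ext e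
    exact congrArg (·.hom) this
  · obtain ⟨t, ht⟩ := h (ObjectProperty.homMk g : Y ⟶ ⟨W, hP W⟩) (InducedCategory.hom_ext hg)
    exact ⟨t.hom, congrArg (·.hom) ht⟩

theorem isZero_obj_iff (X : P.FullSubcategory) : IsZero X.obj ↔ IsZero X := by
  rw [IsZero.iff_id_eq_zero, IsZero.iff_id_eq_zero]
  exact ⟨fun h => InducedCategory.hom_ext h, fun h => congrArg (·.hom) h⟩

theorem simple_obj_iff_of_forall (hP : ∀ X, P X) (X : P.FullSubcategory) :
    Simple X.obj ↔ Simple X := by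
  have := isEquivalence_ι hP
  exact simple_obj_iff P.ι X

end FullSubcategory

section Bar

variable {C : Type u} [Bicategory.{w, v} C] [∀ i j : C, Preadditive (i ⟶ j)]
  [∀ i j : C, HasBinaryBiproducts (i ⟶ j)] {j l : C} {E : j ⟶ j} {τ : E ⟶ 𝟙 j}
  {D : Type u'} [Category.{v'} D] [HasZeroMorphisms D] {Φ : (j ⟶ l) ⥤ D}

/-- Killing `barDiff` means descending along the augmentation at `G`. The descended morphism kills
`a` as soon as the original kills `E ◁ a`, since the augmentation at `F` is an epimorphism. -/
theorem isCoker_map_desc_bar (hΦ : ReflectsZero Φ)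
    (hbar : ∀ H : j ⟶ l, IsCoker (Φ.map (barDiff τ H)) (Φ.map (barAug τ H))) {F G : j ⟶ l}
    {a : F ⟶ G} {X : D} {p : Φ.obj G ⟶ X} (hp : IsCoker (Φ.map a) p) :
    IsCoker (Φ.map (biprod.desc (barDiff τ G) (E ◁ a))) (Φ.map (barAug τ G) ≫ p) := by
  obtain ⟨_, h0, h⟩ := isCoker_iff.1 hp
  obtain ⟨_, hG0, hG⟩ := isCoker_iff.1 (hbar G)
  have := (hbar F).epi
  refine isCoker_map_desc hΦ ?_ ?_ fun g hg hg' => ?_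
  · rw [reassoc_of% hG0, zero_comp]
  · rw [← Category.assoc, ← Φ.map_comp, barAug_naturality, Φ.map_comp, Category.assoc, h0,
      comp_zero]
  · obtain ⟨t, rfl⟩ := hG g hg
    obtain ⟨t', rfl⟩ := h t (by
      rw [← cancel_epi (Φ.map (barAug τ F)), comp_zero, ← Category.assoc, ← Φ.map_comp,
        ← barAug_naturality, Φ.map_comp, Category.assoc, hg'])
    exact ⟨t', by rw [Category.assoc]⟩

/-- Presentations may be replaced by presentations through 1-morphisms starting with `E`. -/
theorem GeneratesAt.bar [Biadditive C] (hΦ : ReflectsZero Φ)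
    (hbar : ∀ H : j ⟶ l, IsCoker (Φ.map (barDiff τ H)) (Φ.map (barAug τ H)))
    {S : ObjectProperty (j ⟶ l)} (hS : ∀ H, S (E ≫ H))
    (hS' : ∀ H K, S (((E ≫ E) ≫ H) ⊞ (E ≫ K))) {X Y : D} (h : GeneratesAt Φ ⊤ X Y) :
    GeneratesAt Φ S X Y := by
  obtain ⟨α, β, p, q, -, hp, hq, h⟩ := h
  refine ⟨⟨biprod.desc (barDiff τ α.tgt) (E ◁ α.hom)⟩, ⟨biprod.desc (barDiff τ β.tgt) (E ◁ β.hom)⟩,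
    Φ.map (barAug τ α.tgt) ≫ p, Φ.map (barAug τ β.tgt) ≫ q, ⟨hS' _ _, hS _, hS' _ _, hS _⟩,
    isCoker_map_desc_bar hΦ hbar hp, isCoker_map_desc_bar hΦ hbar hq, fun f => ?_⟩
  obtain ⟨s, hs⟩ := h f
  -- The bar complex is natural in the 1-morphism, so the square `s` induces a square of the new
  -- presentations.
  refine ⟨⟨biprod.map ((E ≫ E) ◁ s.right) (E ◁ s.left), E ◁ s.right, ?_⟩, ?_⟩
  · ext
    · rw [biprod.inl_desc_assoc, biprod.inl_map_assoc, biprod.inl_desc, barDiff_naturality]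
    · simp only [biprod.inr_desc_assoc, biprod.inr_map_assoc, biprod.inr_desc]
      rw [← Bicategory.whiskerLeft_comp, s.comm, Bicategory.whiskerLeft_comp]
  · change Φ.map (E ◁ s.right) ≫ _ = _
    rw [← Category.assoc, ← Φ.map_comp, barAug_naturality, Φ.map_comp, Category.assoc, hs,
      Category.assoc]

end Bar

/-! ### Comparison of the cell 2-representation with its restriction. -/

section Restriction

variable {C : Type u} [Bicategory.{w, v} C] [∀ i j : C, Preadditive (i ⟶ j)] [Biadditive C]
  [∀ i j : C, HasBinaryBiproducts (i ⟶ j)]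

theorem presPost_biprod_hom_ext {i j l : C} {U V : j ⟶ l} {X : Pres (i ⟶ j)} {Y : Pres (i ⟶ l)}
    (g : (presPost i (U ⊞ V)).obj X ⟶ Y) (h₁ : (presPost₂ i biprod.inl).app X ≫ g = 0)
    (h₂ : (presPost₂ i biprod.inr).app X ≫ g = 0) : g = 0 := by
  have hcomp : ∀ {F G : j ⟶ l} (a : F ⟶ G) (b : G ⟶ U ⊞ V),
      (presPost₂ i (a ≫ b)).app X = (presPost₂ i a).app X ≫ (presPost₂ i b).app X :=
    fun a b => congrArg (fun t => t.toNatTrans.app X) ((principal i).map₂_comp a b)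
  have hid : (presPost₂ i (𝟙 (U ⊞ V))).app X = 𝟙 _ :=
    congrArg (fun t => t.toNatTrans.app X) ((principal i).map₂_id (U ⊞ V))
  -- This difference equals `biprod.snd ≫ biprod.inr`, which `g` kills by `h₂`; so `g` agrees with
  -- its restriction along `biprod.fst ≫ biprod.inl`, which is zero.
  have h : (presPost₂ i (𝟙 (U ⊞ V) - biprod.fst ≫ biprod.inl)).app X ≫ g = 0 := by
    rw [← biprod.total, add_sub_cancel_left, hcomp, Category.assoc, h₂, comp_zero]
  rwa [presPost₂_sub_comp_eq_zero_iff, hcomp, Category.assoc, h₁, comp_zero, hid,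
    Category.id_comp] at h

variable [∀ i j : C, HasZeroObject (i ⟶ j)]

theorem reflectsZero_evalAt_cellRep (R : Set (Indec C)) (i : C) {j : C}
    (X : (cellRep R i).obj j) (l : C) : ReflectsZero (evalAt (cellRep R i) X l) :=
  fun g h₁ h₂ => InducedCategory.hom_ext
    (presPost_biprod_hom_ext (X := X.obj) g.hom (congrArg (·.hom) h₁) (congrArg (·.hom) h₂))

theorem evalAt_cellRep_map_zero (R : Set (Indec C)) (i : C) {j : C} (X : (cellRep R i).obj j)
    {l : C} (F G : j ⟶ l) : (evalAt (cellRep R i) X l).map (0 : F ⟶ G) = 0 :=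
  InducedCategory.hom_ext (Pres.cls_congr (whiskerLeft_zero X.obj.tgt))

/-- An object of the cell 2-representation annihilated by the ideal `I_Q`, as an object of the
restriction to `C_Q`. -/
def toRestrict {Q R : Set (Indec C)} {i j : C} (X : (cellRep R i).obj j)
    (hX : (cellIdeal Q).annihilated (cellRep R i) j X) : (cellRepRestrict Q R i).obj ⟨⟨j⟩⟩ :=
  (⟨X, hX⟩ : ((cellIdeal Q).annihilated (cellRep R i) j).FullSubcategory)

/-- The object of the cell 2-representation underlying an object of its restriction. -/
def ofRestrict {Q R : Set (Indec C)} {i : C} {j : CellCat Q} (X : (cellRepRestrict Q R i).obj j) :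
    (cellRep R i).obj j.as.as :=
  ObjectProperty.FullSubcategory.obj (P := (cellIdeal Q).annihilated (cellRep R i) j.as.as) X

variable {Q R : Set (Indec C)} {i : C}

theorem GeneratesAt.restrict {j l : CellCat Q} (X₀ : (cellRepRestrict Q R i).obj j)
    {X Y : (cellRepRestrict Q R i).obj l}
    (h : GeneratesAt (evalAt (cellRep R i) (ofRestrict X₀) l.as.as)
      (fun F => CellSubMem Q (quoHom Q F)) (ofRestrict X) (ofRestrict Y)) :
    GeneratesAt (evalAt (cellRepRestrict Q R i) X₀ l) ⊤ X Y := by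
  obtain ⟨α, β, p, q, ⟨h₁, h₂, h₃, h₄⟩, hp, hq, h⟩ := h
  let α' : Pres (j ⟶ l) := Pres.mk (src := (⟨⟨α.src⟩, h₁⟩ : OneSub.Sub.Hom j l))
    (tgt := (⟨⟨α.tgt⟩, h₂⟩ : OneSub.Sub.Hom j l))
    (TwoIdeal.Quo.cls (I := cellIdeal Q) (i := j.as) (j := l.as) (F := ⟨_⟩) (G := ⟨_⟩) α.hom)
  let β' : Pres (j ⟶ l) := Pres.mk (src := (⟨⟨β.src⟩, h₃⟩ : OneSub.Sub.Hom j l))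
    (tgt := (⟨⟨β.tgt⟩, h₄⟩ : OneSub.Sub.Hom j l))
    (TwoIdeal.Quo.cls (I := cellIdeal Q) (i := j.as) (j := l.as) (F := ⟨_⟩) (G := ⟨_⟩) β.hom)
  refine ⟨α', β', ObjectProperty.homMk p, ObjectProperty.homMk q,
    ⟨trivial, trivial, trivial, trivial⟩, IsCoker.of_hom hp, IsCoker.of_hom hq, fun f => ?_⟩
  obtain ⟨s, hs⟩ := h f.hom
  exact ⟨⟨TwoIdeal.Quo.cls (I := cellIdeal Q) (i := j.as) (j := l.as) (F := ⟨_⟩) (G := ⟨_⟩) s.left,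
    TwoIdeal.Quo.cls (I := cellIdeal Q) (i := j.as) (j := l.as) (F := ⟨_⟩) (G := ⟨_⟩) s.right,
    congrArg (Quotient.mk _) s.comm⟩, InducedCategory.hom_ext hs⟩

end Restriction

section Restriction

variable {k : Type v'} [Field k] {C : Type u} [Bicategory.{w, v} C]
  [∀ i j : C, Preadditive (i ⟶ j)] [∀ i j : C, Linear k (i ⟶ j)]
  [∀ i j : C, HasZeroObject (i ⟶ j)] [∀ i j : C, HasBinaryBiproducts (i ⟶ j)] [IsFinitary C k]
  {Q R : Set (Indec C)} {i : C}

/-- Lifted squares commute only up to the ideal. The second presentation is enlarged by `z`, through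
which every such error factors. -/
theorem GeneratesAt.of_restrict (hann : ∀ (j : C) X, (cellIdeal Q).annihilated (cellRep R i) j X)
    {j l : CellCat Q} (X₀ : (cellRepRestrict Q R i).obj j)
    {X Y : (cellRepRestrict Q R i).obj l}
    (h : GeneratesAt (evalAt (cellRepRestrict Q R i) X₀ l) ⊤ X Y) :
    GeneratesAt (evalAt (cellRep R i) (ofRestrict X₀) l.as.as) ⊤ (ofRestrict X) (ofRestrict Y) := by
  have hA := IsFinitary.isFinitaryCategory (k := k) j.as.as l.as.as
  obtain ⟨⟨a⟩, ⟨b⟩, p, q, -, hp, hq, h⟩ := h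
  rename_i F₁ F₀ G₁ G₀
  obtain ⟨a, rfl⟩ : ∃ a' : F₁.as.as ⟶ F₀.as.as,
    TwoIdeal.Quo.cls (I := cellIdeal Q) (F := ⟨_⟩) (G := ⟨_⟩) a' = a := Quotient.exists_rep a
  obtain ⟨b, rfl⟩ : ∃ b' : G₁.as.as ⟶ G₀.as.as,
    TwoIdeal.Quo.cls (I := cellIdeal Q) (F := ⟨_⟩) (G := ⟨_⟩) b' = b := Quotient.exists_rep b
  obtain ⟨Z, z, hz, hZ⟩ := exists_generator hA (B := G₀.as.as) (fun V v => CellIdealMem Q v)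
    (fun V => .zero_mem _ _) (fun V x y => .add_mem) (fun V W x y => .comp_left x)
  have hz0 : (evalAt (cellRep R i) (ofRestrict X₀) l.as.as).map z = 0 :=
    (hann _ (ofRestrict X₀) z 0 (by rw [sub_zero]; exact hz)).trans
      (evalAt_cellRep_map_zero R i (ofRestrict X₀) _ _)
  have hp' := IsCoker.hom (hann l.as.as) hp
  have hq' := IsCoker.hom (hann l.as.as) hq
  refine ⟨⟨a⟩, ⟨biprod.desc b z⟩, p.hom, q.hom, ⟨trivial, trivial, trivial, trivial⟩, hp',
    isCoker_map_desc_of_map_eq_zero (reflectsZero_evalAt_cellRep R i _ _) hz0 hq', fun f => ?_⟩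
  obtain ⟨⟨x, y, hxy⟩, hs⟩ := h (ObjectProperty.homMk f)
  obtain ⟨x, rfl⟩ : ∃ x' : F₁.as.as ⟶ G₁.as.as,
    TwoIdeal.Quo.cls (I := cellIdeal Q) (F := ⟨_⟩) (G := ⟨_⟩) x' = x := Quotient.exists_rep x
  obtain ⟨y, rfl⟩ : ∃ y' : F₀.as.as ⟶ G₀.as.as,
    TwoIdeal.Quo.cls (I := cellIdeal Q) (F := ⟨_⟩) (G := ⟨_⟩) y' = y := Quotient.exists_rep y
  have hmem : CellIdealMem Q (a ≫ y - x ≫ b) :=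
    (TwoIdeal.Quo.cls_eq_iff (I := cellIdeal Q) (F := F₁.as) (G := G₀.as) _ _).1 hxy
  obtain ⟨t, ht⟩ := hZ _ hmem
  -- The component `t` compensates the error `a ≫ y - x ≫ b = t ≫ z`. The right component is
  -- unchanged, so the evaluation is too.
  exact ⟨⟨biprod.lift x t, y, by rw [biprod.lift_desc, ht]; abel⟩, congrArg (·.hom) hs⟩

/-- The restriction is defined on the annihilated part of $\mathbf C_{\mathcal R}$; this shows that
part to be everything. -/
theorem annihilated_cellRep (I : Involution C)
    (hI : ∀ {i j : C} (F : i ⟶ j), Nonempty (Bicategory.Adjunction F (I.star F)))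
    (hRQ : R ⊆ Q) (j : C) (X : (cellRep R i).obj j) :
    (cellIdeal Q).annihilated (cellRep R i) j X := by
  intro l F G α β h
  obtain ⟨ξ, hξ⟩ := actsByZero_of_cellIdealMem (k := k) I hI hRQ h X.property
  refine InducedCategory.hom_ext ((Pres.cls_eq_iff _ _).2 ⟨ξ, ?_⟩)
  exact (whiskerLeft_sub _ _ _).symm.trans hξ

/-- The bar construction, with `E` adapted to `X₀`, gives one direction; lifting along the quotient
gives the other. -/
theorem generates_cellRepRestrict_iff (I : Involution C)
    (hI : ∀ {i j : C} (F : i ⟶ j), Nonempty (Bicategory.Adjunction F (I.star F)))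
    (hQ : IsTwoSidedCell Q) (hRQ : R ⊆ Q) {j : CellCat Q} (X₀ : (cellRepRestrict Q R i).obj j) :
    Generates (cellRep R i) (ofRestrict X₀) ↔ Generates (cellRepRestrict Q R i) X₀ := by
  have hann := annihilated_cellRep (k := k) (i := i) I hI hRQ
  rw [generates_iff, generates_iff]
  constructor
  · intro h l X Y
    obtain ⟨D, hD, -, hX₀⟩ := (ofRestrict X₀).property
    obtain ⟨E, τ, hE, hbar⟩ := exists_isCoker_barDiff (k := k) hQ hRQ
      (fun F => ⟨I.star F, hI F⟩) (hD _ _ hX₀)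
    refine GeneratesAt.restrict X₀ (GeneratesAt.bar (τ := τ)
      (reflectsZero_evalAt_cellRep R i _ _) (fun H => IsCoker.of_hom (hbar H)) (fun H => hE H)
      (fun H K => ?_) (h l.as.as (ofRestrict X) (ofRestrict Y)))
    -- Up to associativity `(E ≫ E) ≫ H` is `E ≫ (E ≫ H)`, again a composition starting with `E`.
    exact .biprod_mem (.summand_mem ⟨quoRetract Q (Retract.ofIso (α_ E E H))⟩ (hE _)) (hE K)
  · intro h l X Y
    exact GeneratesAt.of_restrict (k := k) hann X₀
      (h ⟨⟨l⟩⟩ (toRestrict X (hann l X)) (toRestrict Y (hann l Y)))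

theorem isStronglySimple_cellRepRestrict_iff (I : Involution C)
    (hI : ∀ {i j : C} (F : i ⟶ j), Nonempty (Bicategory.Adjunction F (I.star F)))
    (hQ : IsTwoSidedCell Q) (hRQ : R ⊆ Q) :
    IsStronglySimple (cellRep R i) ↔ IsStronglySimple (cellRepRestrict Q R i) := by
  have hann := annihilated_cellRep (k := k) (i := i) I hI hRQ
  have hgen := fun {j} X₀ => generates_cellRepRestrict_iff (k := k) (i := i) I hI hQ hRQ (j := j) X₀
  have hsimple : ∀ {j : CellCat Q} (X : (cellRepRestrict Q R i).obj j),
      Simple (ofRestrict X) ↔ Simple X := fun {j} X => simple_obj_iff_of_forall (hann j.as.as) X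
  have hzero : ∀ {j : CellCat Q} (X : (cellRepRestrict Q R i).obj j),
      IsZero (ofRestrict X) ↔ IsZero X := fun X => isZero_obj_iff X
  refine and_congr ?_ (and_congr ?_ ?_)
  · exact ⟨fun ⟨j, X, hX⟩ => ⟨⟨⟨j⟩⟩, toRestrict X (hann j X), fun h => hX ((hzero _).2 h)⟩,
      fun ⟨j, X, hX⟩ => ⟨j.as.as, ofRestrict X, fun h => hX ((hzero X).1 h)⟩⟩
  · exact ⟨fun ⟨j, X, hX⟩ => ⟨⟨⟨j⟩⟩, toRestrict X (hann j X), (hgen _).1 hX⟩,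
      fun ⟨j, X, hX⟩ => ⟨j.as.as, ofRestrict X, (hgen X).2 hX⟩⟩
  · exact ⟨fun h j X hX => (hgen X).1 (h _ _ ((hsimple X).2 hX)),
      fun h j X hX => (hgen (toRestrict X (hann j X))).2 (h ⟨⟨j⟩⟩ _ ((hsimple _).1 hX))⟩

end Restriction

end CellRep

theorem proposition9 {k : Type v'} [Field k] [IsAlgClosed k]
    {C : Type u} [Bicategory.{w, v} C]
    [∀ i j : C, Preadditive (i ⟶ j)] [∀ i j : C, Linear k (i ⟶ j)]
    [∀ i j : C, HasZeroObject (i ⟶ j)] [∀ i j : C, HasBinaryBiproducts (i ⟶ j)]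
    [Bicategory.Strict C] [IsFiat C k]
    (Q : Set (Indec C)) (hQ : IsTwoSidedCell Q) (hreg : IsStronglyRegular Q)
    (R : Set (Indec C)) (hR : IsRightCell R) (hRQ : R ⊆ Q)
    (i : C) (hi : ∃ F ∈ R, F.src = i) :
    IsStronglySimple (cellRep R i) ↔ IsStronglySimple (cellRepRestrict Q R i) := by
  obtain ⟨I, hI⟩ := IsFiat.exists_involution (C := C) (k := k)
  exact isStronglySimple_cellRepRestrict_iff (k := k) I hI hQ hRQ
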